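/- Let $n,m\ge 1$, $q_1,\dots,q_n$ and $p_1,\dots,p_m$ be dimensions, $Q=\prod_{i=1}^n q_i$, and consider the tensor-on-tensor regression $$Y_i=\langle A^*,X_i\rangle+E_i,\qquad 1\le i\le N,$$ with $Y_i,E_i\in\mathbb R^{q_1\times\cdots\times q_n}$, $X_i\in\mathbb R^{p_1\times\cdots\times p_m}$, $A^*\in\mathbb R^{q_1\times\cdots\times q_n\times p_1\times\cdots\times p_m}$ and $\langle A,X\rangle_{j_1\dots j_n}=\sum_{l_1,\dots,l_m}A_{j_1\dots j_n l_1\dots l_m}X_{l_1\dots l_m}$. For a tensor $A$ of order $m+n$ let $[A]_k$ be its $k$-th sequential matricization (rows indexed by the first $k$ modes, columns by the remaining ones); $A$ has TT ranks $R=(r_1,\dots,r_{m+n-1})$ if $\operatorname{rank}[A]_k=r_k$ for all $k$. A random vector $x$ is called $s$-sub-Gaussian if $\mathbb E\,e^{t\langle v,x\rangle}\le e^{s\|v\|^2t^2/2}$ for every vector $v$ and every $t\in\mathbb R$. Assume that the pairs $(X_i,E_i)$, $1\le i\le N$, are independent across $i$, and that: (1) the vectorized predictors $x_i=\mathrm{vec}(X_i)$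 are identically distributed, $\sigma^2$-sub-Gaussian, with mean zero and covariance matrix $\Sigma_x$ satisfying $c_xI\preceq\Sigma_x\preceq C_xI$, where $0<c_x<C_x<\infty$; (2) the vectorized errors $e_i=\mathrm{vec}(E_i)$ are identically distributed and, conditionally on $x_i$, $e_i$ has mean zero and is $\kappa^2$-sub-Gaussian. Let $A^*$ have TT ranks $R$, let $r_{\max}=\max_k r_k$ and $d_{\mathrm{LR}}=4r_{\max}^2\bigl(\sum_{i=1}^m p_i+\sum_{i=1}^n q_i\bigr)+2r_{\max}$. Then there are absolute constants $c,c_1,C_0>0$ (independent of all the above quantities) such that, if $$N\ge C_0\max\Bigl\{\frac{\sigma^2}{c_x},\frac{\sigma^4}{c_x^2}\Bigr\}\Bigl\{[0.5(m+n)+2]\log\bigl[6\sqrt{C_x/c_x}\,(m+n+1)\bigr]d_{\mathrm{LR}}+\log Q\Bigr\},$$ then, for every $\delta>1$, with probability at least $$1-2Q\exp\Bigl\{-cN\min\Bigl(\frac{c_x}{\sigma^2},\frac{c_x^2}{\sigma^4}\Bigr)+[0.5(m+n)+2]\log\bigl[6\sqrt{C_x/c_x}\,(m+n+1)\bigr]d_{\mathrm{LR}}\Bigr\}-\exp\bigl\{-\delta^2[0.5(m+n)+2]\log(6m+6n+6)\,d_{\mathrm{LR}}\bigr\},$$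 the least squares problem of minimizing $\sum_{i=1}^N\|Y_i-\langle A,X_i\rangle\|_{\mathrm F}^2$ over all $A$ with $\operatorname{rank}[A]_k\le r_k$ for $1\le k\le m+n-1$ has a solution, and every solution $\widehat A_{\mathrm{LR}}$ satisfies $$\|\widehat A_{\mathrm{LR}}-A^*\|_{\mathrm F}\le\frac{\delta c_1\kappa}{c_x}\sqrt{\frac{C_x[0.5(m+n)+2]\log(6m+6n+6)\,d_{\mathrm{LR}}}{N}}.$$ -/

import Mathlib

open MeasureTheory ProbabilityTheory
open scoped NNReal

noncomputable section

namespace TTReg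

/-- Real tensors whose `k`-th mode has dimension `s k`, with the Frobenius inner product and norm.
The vectorization of a tensor is the tensor itself, viewed as a vector indexed by multi-indices. -/
abbrev Tensor {K : Type*} [Fintype K] [DecidableEq K] (s : K → ℕ) : Type _ :=
  EuclideanSpace ℝ ((k : K) → Fin (s k))

variable {n m : ℕ} {q : Fin n → ℕ} {p : Fin m → ℕ}

/-- Coefficient tensors of size `q 0 × ⋯ × q (n-1) × p 0 × ⋯ × p (m-1)`. -/
abbrev Coef (q : Fin n → ℕ) (p : Fin m → ℕ) : Type :=
  Tensor (K := Fin n ⊕ Fin m) (Sum.elim q p)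

/-- The multi-index `(j₁, …, jₙ, l₁, …, lₘ)`. -/
def joinIdx (j : (a : Fin n) → Fin (q a)) (l : (b : Fin m) → Fin (p b)) :
    (k : Fin n ⊕ Fin m) → Fin (Sum.elim q p k)
  | Sum.inl a => j a
  | Sum.inr b => l b

/-- The generalized inner product `⟨A, X⟩`, contracting the last `m` modes of `A` with `X`. -/
def contract (A : Coef q p) (X : Tensor p) : Tensor q :=
  WithLp.toLp 2 fun j => ∑ l, A (joinIdx j l) * X l

/-- The position (counted from `0`) of a mode in the order: the `n` response modes, then the
`m` predictor modes. -/
def pos (k : Fin n ⊕ Fin m) : ℕ := (finSumFinEquiv k : Fin (n + m)).val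

/-- The `i`-th sequential matricization: the rows are indexed by the first `i` modes, the columns
by the remaining ones. -/
def seqMat (A : Coef q p) (i : ℕ) :
    Matrix ((k : {k : Fin n ⊕ Fin m // pos k < i}) → Fin (Sum.elim q p k))
      ((k : {k : Fin n ⊕ Fin m // ¬ pos k < i}) → Fin (Sum.elim q p k)) ℝ :=
  Matrix.of fun a b => A fun k => if h : pos k < i then a ⟨k, h⟩ else b ⟨k, h⟩

/-- `A` has tensor train ranks `(r₁, …, r_{n+m-1})`, where `r k` stands for `r_{k+1}`. -/
def HasTTRanks (A : Coef q p) (r : Fin (n + m - 1) → ℕ) : Prop :=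
  ∀ k, (seqMat A (k.val + 1)).rank = r k

/-- The tensors whose tensor train ranks are at most `(r₁, …, r_{n+m-1})`. -/
def ttSet (q : Fin n → ℕ) (p : Fin m → ℕ) (r : Fin (n + m - 1) → ℕ) : Set (Coef q p) :=
  {A | ∀ k, (seqMat A (k.val + 1)).rank ≤ r k}

/-- The residual sum of squares. -/
def rss {N : ℕ} (Y : Fin N → Tensor q) (X : Fin N → Tensor p) (A : Coef q p) : ℝ :=
  ∑ i, ‖Y i - contract A (X i)‖ ^ 2

/-- `A` is an ordinary least squares estimate over the set of tensors of ranks at most `r`. -/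
def IsOLS {N : ℕ} (r : Fin (n + m - 1) → ℕ) (Y : Fin N → Tensor q) (X : Fin N → Tensor p)
    (A : Coef q p) : Prop :=
  A ∈ ttSet q p r ∧ ∀ B ∈ ttSet q p r, rss Y X A ≤ rss Y X B

/-- The largest tensor train rank. -/
def rMax (r : Fin (n + m - 1) → ℕ) : ℕ := Finset.univ.sup r

/-- The model complexity `4 r_max² (∑ pᵢ + ∑ qᵢ) + 2 r_max`. -/
def dLR (q : Fin n → ℕ) (p : Fin m → ℕ) (r : Fin (n + m - 1) → ℕ) : ℝ :=
  4 * (rMax r : ℝ) ^ 2 * (∑ b, (p b : ℝ) + ∑ a, (q a : ℝ)) + 2 * (rMax r : ℝ)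

/-- The distribution `ν` of a random vector is `s`-sub-Gaussian (`s` is the variance proxy):
`𝔼 exp (t ⟨v, x⟩) ≤ exp (s ‖v‖² t² / 2)` for every vector `v` and every real `t`. -/
def IsSubGaussianVec {ι : Type*} [Fintype ι] (ν : Measure (EuclideanSpace ℝ ι)) (s : ℝ≥0) :
    Prop :=
  ∀ v : EuclideanSpace ℝ ι, HasSubgaussianMGF (fun x => inner ℝ v x) (s * ‖v‖₊ ^ 2) ν

/-- The covariance matrix of a random vector with distribution `ν`. -/
def covMatrix {ι : Type*} [Fintype ι] (ν : Measure (EuclideanSpace ℝ ι)) : Matrix ι ι ℝ :=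
  Matrix.of fun j k => covariance (fun x => x j) (fun x => x k) ν

/-- Assumption on the predictors: identically distributed, centred, `σ²`-sub-Gaussian, with
`c_x I ≤ var(x) ≤ C_x I` in the Loewner order. (Independence is stated separately.) -/
structure PredictorAssumption {Ω : Type*} [MeasurableSpace Ω] (μ : Measure Ω) {N : ℕ}
    (X : Fin N → Ω → Tensor p) (σ : ℝ≥0) (cx Cx : ℝ) : Prop where
  measurable : ∀ i, Measurable (X i)
  identDistrib : ∀ i j, IdentDistrib (X i) (X j) μ μ
  mean_zero : ∀ i, ∫ ω, X i ω ∂μ = 0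
  subGaussian : ∀ i, IsSubGaussianVec (μ.map (X i)) (σ ^ 2)
  cov_lower : ∀ i, (covMatrix (μ.map (X i)) - cx • (1 : Matrix _ _ ℝ)).PosSemidef
  cov_upper : ∀ i, (Cx • (1 : Matrix _ _ ℝ) - covMatrix (μ.map (X i))).PosSemidef

/-- Assumption on the errors: identically distributed and, conditionally on the predictor of the
same observation, centred and `κ²`-sub-Gaussian. (Independence is stated separately.) -/
structure ErrorAssumption {Ω : Type*} [MeasurableSpace Ω] (μ : Measure Ω) [IsFiniteMeasure μ]
    {N : ℕ} (X : Fin N → Ω → Tensor p) (E : Fin N → Ω → Tensor q) (κ : ℝ≥0) : Prop where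
  measurable : ∀ i, Measurable (E i)
  identDistrib : ∀ i j, IdentDistrib (E i) (E j) μ μ
  cond_mean_zero : ∀ i, ∀ᵐ x ∂(μ.map (X i)), ∫ e, e ∂(condDistrib (E i) (X i) μ x) = 0
  cond_subGaussian : ∀ i, ∀ᵐ x ∂(μ.map (X i)),
    IsSubGaussianVec (condDistrib (E i) (X i) μ x) (κ ^ 2)

end TTReg

end

open TTReg

/-!
On an event of high probability the least squares problem over tensors of bounded tensor train
ranks behaves like least squares with a well conditioned design.

Every difference `A - A₀` of admissible tensors has tensor train ranks at most `R = 2 r_max`.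
Scaled to norm one it is the value of a multilinear map (`TTReg.coefMap`) at a train of `n + m`
cores, each an operator `ℝ^R → ℝ^s ⊗ ℝ^R` of norm at most one (`TTReg.exists_cores`): the cores
are found by splitting off one mode at a time and projecting on the column space of the
matricization. The unit ball of the cores of one mode has an `ε`-net of `(3 / ε) ^ (R² s)` points
by a volume argument, so all modes together need at most `exp (log (3 / ε) d_LR)` trains of net
points (`TTReg.exists_core_nets`). Replacing the cores by net points one by one shows that a
sublinear function of the tensor is controlled on all trains once it is controlled on the trains of
net points (`MultilinearMap.sublinear_sub_le`, `MultilinearMap.sublinear_le_of_net`). This needs no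
covering of differences of tensors: each term of the telescoping sum is again a train of contractive
cores, times `ε`.

Two functions are controlled in this way.

* The norm of the design map `A ↦ (⟨A, X_i⟩)_i`. For a fixed tensor its square is a sum over the
  entries of the response of sums of squares `∑ i, ⟨v, x_i⟩²`, which concentrate by Bernstein's
  inequality for squares of sub-Gaussian variables (`measureReal_sum_sq_deviation_le`); the union
  bound over the entries gives the factor `Q`. With nets of resolution of order
  `√(c_x / C_x) / (n + m)`, the squared norm is at least `c_x N / 4` and at most a multiple of
  `C_x N` on all trains of norm one (`TTReg.exists_uniform_design_event`).
* The noise `∑ i, ⟨E_i, ⟨A, X_i⟩⟩`. The exponentials of its terms, compensated by the conditional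
  variance proxies, are independent with expectation at most one, which gives a sub-Gaussian tail on
  the event that `∑ i, ‖⟨A, X_i⟩‖²` is bounded, without conditioning on all the predictors at once
  (`TTReg.measureReal_noise_gt_le`). Here nets of resolution of order `1 / (n + m)` suffice
  (`TTReg.exists_uniform_noise_event`).

The basic inequality of least squares turns the two bounds into the error bound, and the lower
bound on the design, together with the closedness of the set of admissible tensors, gives
the existence of a minimizer (`TTReg.leastSquares_exists_and_error_le`).
-/

/-! ### Nets of unit balls and sublinear functions of multilinear maps -/

/-- Volumetric bound for separated subsets of the unit ball: the balls of radius `ε / 2` around the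
points are disjoint and lie in a ball of radius `3 / 2`. -/
lemma card_le_of_separated_unitBall {V : Type*} [NormedAddCommGroup V] [NormedSpace ℝ V]
    [FiniteDimensional ℝ V] {ε : ℝ} (hε : 0 < ε) (hε1 : ε ≤ 1) (s : Finset V)
    (hs : ∀ c ∈ s, ‖c‖ ≤ 1) (h : ∀ c ∈ s, ∀ d ∈ s, c ≠ d → ε ≤ ‖c - d‖) :
    (s.card : ℝ) ≤ (3 / ε) ^ Module.finrank ℝ V := by
  borelize V
  let μ : Measure V := Measure.addHaar
  have hδ : 0 < ε / 2 := by positivity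
  have D : Set.Pairwise (s : Set V) (Function.onFun Disjoint fun c => Metric.ball c (ε / 2)) := by
    rintro c hc d hd hcd
    apply Metric.ball_disjoint_ball
    rw [dist_eq_norm, add_halves]
    exact h c hc d hd hcd
  have A_subset : (⋃ c ∈ s, Metric.ball c (ε / 2)) ⊆ Metric.ball (0 : V) (3 / 2) := by
    refine Set.iUnion₂_subset fun x hx => Metric.ball_subset_ball' ?_
    rw [dist_zero_right]
    linarith [hs x hx]
  have I : (s.card : ENNReal) * ENNReal.ofReal ((ε / 2) ^ Module.finrank ℝ V)
      * μ (Metric.ball 0 1) ≤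
      ENNReal.ofReal ((3 / 2) ^ Module.finrank ℝ V) * μ (Metric.ball 0 1) :=
    calc
      _ = μ (⋃ c ∈ s, Metric.ball c (ε / 2)) := by
        rw [measure_biUnion_finset D fun c _ => measurableSet_ball]
        simp only [μ.addHaar_ball_of_pos _ hδ, Finset.sum_const, nsmul_eq_mul, mul_assoc]
      _ ≤ μ (Metric.ball (0 : V) (3 / 2)) := measure_mono A_subset
      _ = _ := by simp only [μ.addHaar_ball_of_pos _ (show (0 : ℝ) < 3 / 2 by norm_num)]
  have J := (ENNReal.mul_le_mul_iff_left (Metric.measure_ball_pos _ _ zero_lt_one).ne'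
    measure_ball_lt_top.ne).1 I
  have K := ENNReal.toReal_le_of_le_ofReal (by positivity) J
  rw [ENNReal.toReal_mul, ENNReal.toReal_natCast, ENNReal.toReal_ofReal (by positivity)] at K
  have : (3 / ε) ^ Module.finrank ℝ V
      = (3 / 2) ^ Module.finrank ℝ V / (ε / 2) ^ Module.finrank ℝ V := by
    rw [← div_pow]; congr 1; field_simp
  rw [this, le_div_iff₀ (by positivity)]
  exact K

/-- The unit ball of a normed space of dimension `D` has an `ε`-net of at most `(3 / ε) ^ D` of
its points, for `0 < ε ≤ 1`. -/
lemma exists_net_unitBall (V : Type*) [NormedAddCommGroup V] [NormedSpace ℝ V]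
    [FiniteDimensional ℝ V] {ε : ℝ} (hε : 0 < ε) (hε1 : ε ≤ 1) :
    ∃ s : Finset V, (∀ c ∈ s, ‖c‖ ≤ 1) ∧ (∀ x : V, ‖x‖ ≤ 1 → ∃ c ∈ s, ‖x - c‖ ≤ ε) ∧
      (s.card : ℝ) ≤ (3 / ε) ^ Module.finrank ℝ V := by
  classical
  -- a separated set with the most points is a net
  let P : ℕ → Prop := fun k => ∃ s : Finset V, s.card = k ∧ (∀ c ∈ s, ‖c‖ ≤ 1) ∧
    ∀ c ∈ s, ∀ d ∈ s, c ≠ d → ε ≤ ‖c - d‖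
  have hb : ∀ k, P k → k ≤ ⌊(3 / ε) ^ Module.finrank ℝ V⌋₊ := by
    rintro k ⟨s, rfl, h1, h2⟩
    exact Nat.le_floor (card_le_of_separated_unitBall hε hε1 s h1 h2)
  have h0 : P 0 := ⟨∅, by simp⟩
  obtain ⟨s, hcard, h1, h2⟩ := Nat.findGreatest_spec (P := P) (Nat.zero_le _) h0
  refine ⟨s, h1, fun x hx => ?_, card_le_of_separated_unitBall hε hε1 s h1 h2⟩
  by_contra! hcon
  have hxs : x ∉ s := fun hxs => by
    have := hcon x hxs
    simp at this
    linarith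
  have hP : P (s.card + 1) := by
    refine ⟨insert x s, Finset.card_insert_of_notMem hxs, ?_, ?_⟩
    · intro c hc
      rcases Finset.mem_insert.1 hc with rfl | hc
      · exact hx
      · exact h1 c hc
    · intro c hc d hd hcd
      rcases Finset.mem_insert.1 hc with hc' | hc' <;>
        rcases Finset.mem_insert.1 hd with hd' | hd'
      · exact absurd (hc'.trans hd'.symm) hcd
      · rw [hc']; exact (hcon d hd').le
      · rw [hd', norm_sub_rev]; exact (hcon c hc').le
      · exact h2 c hc' d hd' hcd
  have := Nat.le_findGreatest (hb _ hP) hP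
  rw [← hcard] at this
  exact absurd this (Nat.not_succ_le_self _)

section Multilinear

variable {ι : Type*} [Fintype ι] [DecidableEq ι] {V : ι → Type*}
  [∀ k, NormedAddCommGroup (V k)] [∀ k, NormedSpace ℝ (V k)] {W : Type*} [AddCommGroup W]
  [Module ℝ W]

/-- Telescoping: if a sublinear function is at most `M` on the image of the product of the unit
balls under a multilinear map, then it is at most `M ε` per factor on the difference of the values
at two `ε`-close points of that product. -/
lemma MultilinearMap.sublinear_sub_le (F : MultilinearMap ℝ V W) (g : W → ℝ)
    (hadd : ∀ x y, g (x + y) ≤ g x + g y) (hsmul : ∀ (c : ℝ) (x), 0 ≤ c → g (c • x) = c * g x)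
    {M ε : ℝ} (hε : 0 < ε) (hM : ∀ G : ∀ k, V k, (∀ k, ‖G k‖ ≤ 1) → g (F G) ≤ M)
    (G G' : ∀ k, V k) (hG : ∀ k, ‖G k‖ ≤ 1) (hG' : ∀ k, ‖G' k‖ ≤ 1)
    (hGG' : ∀ k, ‖G k - G' k‖ ≤ ε) :
    g (F G - F G') ≤ Fintype.card ι * ε * M := by
  have key : ∀ s : Finset ι, g (F G - F (s.piecewise G' G)) ≤ s.card * ε * M := by
    intro s
    induction s using Finset.induction_on with
    | empty =>
      have := hsmul 0 0 le_rfl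
      simp only [smul_zero, zero_mul] at this
      simp [this]
    | insert k s hk ih =>
      set H : ∀ k, V k := s.piecewise G' G with hH
      have hHk : H k = G k := by simp [hH, hk]
      have hHb : ∀ j, ‖H j‖ ≤ 1 := fun j => by
        by_cases hj : j ∈ s <;> simp [hH, hj, hG, hG']
      have hins : (insert k s).piecewise G' G = Function.update H k (G' k) := by
        rw [Finset.piecewise_insert]
      have hupd : F H - F ((insert k s).piecewise G' G)
          = ε • F (Function.update H k (ε⁻¹ • (G k - G' k))) := by
        rw [hins, F.map_update_smul, smul_smul, mul_inv_cancel₀ hε.ne', one_smul,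
          F.map_update_sub, ← hHk, Function.update_eq_self]
      have hle : g (F (Function.update H k (ε⁻¹ • (G k - G' k)))) ≤ M := by
        refine hM _ fun j => ?_
        by_cases hj : j = k
        · subst hj
          rw [Function.update_self, norm_smul, norm_inv, Real.norm_of_nonneg hε.le,
            inv_mul_le_iff₀ hε, mul_one]
          exact hGG' j
        · rw [Function.update_of_ne hj]
          exact hHb j
      calc g (F G - F ((insert k s).piecewise G' G))
          = g ((F G - F H) + (F H - F ((insert k s).piecewise G' G))) := by congr 1; abel
        _ ≤ s.card * ε * M + ε * M := by
            refine (hadd _ _).trans (add_le_add ih ?_)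
            rw [hupd, hsmul _ _ hε.le]
            gcongr
        _ = _ := by rw [Finset.card_insert_of_notMem hk]; push_cast; ring
  simpa using key Finset.univ

/-- A sublinear function that is at most `m` on the image of a product of fine enough nets of the
unit balls is at most `2 m` on the image of the product of the unit balls. -/
lemma MultilinearMap.sublinear_le_of_net [Nonempty ι] (F : MultilinearMap ℝ V W) (g : W → ℝ)
    (hadd : ∀ x y, g (x + y) ≤ g x + g y) (hsmul : ∀ (c : ℝ) (x), 0 ≤ c → g (c • x) = c * g x)
    {C m ε : ℝ} (hε : 0 < ε) (hι : Fintype.card ι * ε ≤ 1 / 2)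
    (hC : ∀ G : ∀ k, V k, (∀ k, ‖G k‖ ≤ 1) → g (F G) ≤ C) (S : ∀ k, Finset (V k))
    (hS : ∀ k, ∀ c ∈ S k, ‖c‖ ≤ 1) (hnet : ∀ k, ∀ x : V k, ‖x‖ ≤ 1 → ∃ c ∈ S k, ‖x - c‖ ≤ ε)
    (hm : ∀ G : ∀ k, V k, (∀ k, G k ∈ S k) → g (F G) ≤ m)
    (G : ∀ k, V k) (hG : ∀ k, ‖G k‖ ≤ 1) : g (F G) ≤ 2 * m := by
  let T : Set ℝ := {t | ∃ H : ∀ k, V k, (∀ k, ‖H k‖ ≤ 1) ∧ g (F H) = t}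
  have hbdd : BddAbove T := ⟨C, by rintro _ ⟨H, hH, rfl⟩; exact hC H hH⟩
  have hle : ∀ H : ∀ k, V k, (∀ k, ‖H k‖ ≤ 1) → g (F H) ≤ sSup T :=
    fun H hH => le_csSup hbdd ⟨H, hH, rfl⟩
  have h0 : 0 ≤ sSup T := by
    have h := hle 0 (by simp)
    have hg := hsmul 0 0 le_rfl
    simp only [smul_zero, zero_mul] at hg
    rwa [F.map_zero, hg] at h
  have hhalf : sSup T ≤ m + 1 / 2 * sSup T := by
    refine csSup_le ⟨_, G, hG, rfl⟩ ?_
    rintro _ ⟨H, hH, rfl⟩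
    choose c hcS hc using fun k => hnet k (H k) (hH k)
    calc g (F H) = g (F c + (F H - F c)) := by congr 1; abel
      _ ≤ g (F c) + g (F H - F c) := hadd _ _
      _ ≤ m + Fintype.card ι * ε * sSup T :=
          add_le_add (hm c hcS) (F.sublinear_sub_le g hadd hsmul hε hle H c hH
            (fun k => hS k _ (hcS k)) hc)
      _ ≤ _ := by gcongr
  linarith [hle G hG]

end Multilinear

/-! ### Contractions and low-rank factorizations -/

/-- A subspace of dimension at most `R` is the range of a contraction `U` defined on `ℝ^R` that
has a contractive right inverse there. -/
lemma Submodule.exists_contraction_section {H : Type*} [NormedAddCommGroup H]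
    [InnerProductSpace ℝ H] [FiniteDimensional ℝ H] (W : Submodule ℝ H) {R : ℕ}
    (hW : Module.finrank ℝ W ≤ R) :
    ∃ (U : EuclideanSpace ℝ (Fin R) →L[ℝ] H) (P : H →L[ℝ] EuclideanSpace ℝ (Fin R)),
      ‖U‖ ≤ 1 ∧ ‖P‖ ≤ 1 ∧ ∀ w ∈ W, U (P w) = w := by
  let b := stdOrthonormalBasis ℝ W
  let f : W →ₗ[ℝ] EuclideanSpace ℝ (Fin R) :=
    b.toBasis.constr ℝ fun k => EuclideanSpace.single (Fin.castLE hW k) (1 : ℝ)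
  have hf : Orthonormal ℝ (f ∘ b.toBasis) := by
    have : f ∘ b.toBasis = (fun k => EuclideanSpace.single k (1 : ℝ)) ∘ Fin.castLE hW := by
      funext k
      simp [f]
    rw [this]
    exact (EuclideanSpace.orthonormal_single).comp _ (Fin.castLE_injective hW)
  let J : W →ₗᵢ[ℝ] EuclideanSpace ℝ (Fin R) :=
    f.isometryOfOrthonormal (v := b.toBasis) (by simp [b.orthonormal]) hf
  refine ⟨W.subtypeL ∘L ContinuousLinearMap.adjoint J.toContinuousLinearMap,
    J.toContinuousLinearMap ∘L W.orthogonalProjectionOnto, ?_, ?_, ?_⟩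
  · refine (ContinuousLinearMap.opNorm_comp_le _ _).trans ?_
    rw [LinearIsometryEquiv.norm_map]
    exact mul_le_one₀ W.norm_subtypeL_le (norm_nonneg _) J.norm_toContinuousLinearMap_le
  · refine (ContinuousLinearMap.opNorm_comp_le _ _).trans ?_
    exact mul_le_one₀ J.norm_toContinuousLinearMap_le (norm_nonneg _)
      W.orthogonalProjectionOnto_norm_le
  · intro w hw
    have h1 : W.orthogonalProjectionOnto w = ⟨w, hw⟩ :=
      Submodule.orthogonalProjectionOnto_mem_subspace_eq_self (⟨w, hw⟩ : W)
    have h2 : (ContinuousLinearMap.adjoint J.toContinuousLinearMap) (J ⟨w, hw⟩) = ⟨w, hw⟩ := by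
      refine ext_inner_right ℝ fun v => ?_
      rw [ContinuousLinearMap.adjoint_inner_left]
      exact J.inner_map_map _ _
    simp [h1, h2]

/-- A matrix of rank at most `R` is a product of matrices with inner dimension `R`. -/
lemma Matrix.exists_factorization_of_rank_le {a b : Type*} [Fintype a] [Fintype b]
    (M : Matrix a b ℝ) {R : ℕ} (h : M.rank ≤ R) :
    ∃ (P : a → Fin R → ℝ) (Q : Fin R → b → ℝ), ∀ i j, M i j = ∑ β, Q β j * P i β := by
  classical
  let col : b → EuclideanSpace ℝ a := fun j => WithLp.toLp 2 (M.col j)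
  let W : Submodule ℝ (EuclideanSpace ℝ a) := Submodule.span ℝ (Set.range col)
  have hW : Module.finrank ℝ W ≤ R := by
    rw [Matrix.rank_eq_finrank_span_cols] at h
    have hmap : W = (Submodule.span ℝ (Set.range M.col)).map
        ((WithLp.linearEquiv 2 ℝ (a → ℝ)).symm : (a → ℝ) →ₗ[ℝ] EuclideanSpace ℝ a) := by
      rw [Submodule.map_span, ← Set.range_comp]
      rfl
    rw [hmap, LinearEquiv.finrank_map_eq]
    exact h
  obtain ⟨U, P, -, -, hUP⟩ := W.exists_contraction_section hW
  refine ⟨fun i β => U (EuclideanSpace.single β 1) i, fun β j => P (col j) β, fun i j => ?_⟩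
  have h1 := hUP (col j) (Submodule.subset_span ⟨j, rfl⟩)
  have h2 : P (col j) = ∑ β, P (col j) β • EuclideanSpace.single β (1 : ℝ) := by
    have := (EuclideanSpace.basisFun (Fin R) ℝ).sum_repr (P (col j))
    simpa using this.symm
  rw [h2, map_sum] at h1
  have h3 := congrArg (fun v : EuclideanSpace ℝ a => v i) h1
  simp only [map_smul, WithLp.ofLp_sum, WithLp.ofLp_smul, Finset.sum_apply, Pi.smul_apply,
    smul_eq_mul] at h3
  rw [h3]
  rfl

/-! ### Tensor trains with contractive cores -/

namespace TTReg

/-- A tensor train core with bond dimension `R` and mode dimension `s`, as an operator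
`ℝ^R → ℝ^s ⊗ ℝ^R` with its operator norm. -/
abbrev Core (R s : ℕ) : Type :=
  EuclideanSpace ℝ (Fin R) →L[ℝ] PiLp 2 fun _ : Fin s => EuclideanSpace ℝ (Fin R)

lemma finrank_continuousLinearMap (E F : Type*) [NormedAddCommGroup E] [NormedSpace ℝ E]
    [FiniteDimensional ℝ E] [NormedAddCommGroup F] [NormedSpace ℝ F] [FiniteDimensional ℝ F] :
    Module.finrank ℝ (E →L[ℝ] F) = Module.finrank ℝ E * Module.finrank ℝ F := by
  rw [← (LinearMap.toContinuousLinearMap (𝕜 := ℝ) (E := E) (F' := F)).finrank_eq,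
    Module.finrank_linearMap]

lemma finrank_core (R s : ℕ) : Module.finrank ℝ (Core R s) = R * (s * R) := by
  rw [finrank_continuousLinearMap,
    (WithLp.linearEquiv 2 ℝ (Fin s → EuclideanSpace ℝ (Fin R))).finrank_eq,
    Module.finrank_pi_fintype]
  simp

/-- A linear map sending a unit vector to a given vector, of the least possible norm. -/
lemma exists_continuousLinearMap_apply_eq {E F : Type*} [NormedAddCommGroup E]
    [InnerProductSpace ℝ E] [NormedAddCommGroup F] [NormedSpace ℝ F] {e : E} (he : ‖e‖ = 1)
    (a : F) : ∃ g : E →L[ℝ] F, ‖g‖ ≤ ‖a‖ ∧ g e = a :=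
  ⟨(innerSL ℝ e).smulRight a, by simp [ContinuousLinearMap.norm_smulRight_apply, he],
    by simp [he]⟩

/-- The `i`-th slice of a core, an endomorphism of the bond space. -/
noncomputable def coreSlice {R s : ℕ} (i : Fin s) :
    Core R s →ₗ[ℝ] Module.End ℝ (EuclideanSpace ℝ (Fin R)) where
  toFun G :=
    { toFun := fun v => G v i
      map_add' := fun v w => by simp
      map_smul' := fun c v => by simp }
  map_add' G H := by ext; simp
  map_smul' c G := by ext; simp

@[simp] lemma coreSlice_apply {R s : ℕ} (i : Fin s) (G : Core R s)
    (v : EuclideanSpace ℝ (Fin R)) : coreSlice i G v = G v i := rfl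

variable {R d : ℕ}

/-- The product of the slices of a train of cores selected by a multi-index. -/
noncomputable def ttProd {s : Fin d → ℕ} (G : ∀ k, Core R (s k)) (i : ∀ k, Fin (s k)) :
    Module.End ℝ (EuclideanSpace ℝ (Fin R)) :=
  (List.ofFn fun k => coreSlice (i k) (G k)).prod

@[simp] lemma ttProd_zero {s : Fin 0 → ℕ} (G : ∀ k, Core R (s k)) (i : ∀ k, Fin (s k)) :
    ttProd G i = 1 := by simp [ttProd]

lemma ttProd_succ {s : Fin (d + 1) → ℕ} (G : ∀ k, Core R (s k)) (i : ∀ k, Fin (s k))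
    (v : EuclideanSpace ℝ (Fin R)) :
    ttProd G i v = G 0 (ttProd (fun k : Fin d => G k.succ) (fun k => i k.succ) v) (i 0) := by
  simp [ttProd, List.ofFn_succ]

lemma sum_fin_succ_pi {s : Fin (d + 1) → ℕ} (f : (∀ k, Fin (s k)) → ℝ) :
    ∑ i, f i = ∑ j : ∀ k : Fin d, Fin (s k.succ), ∑ i₀, f (Fin.cons i₀ j) := by
  rw [← (Fin.consEquiv fun k => Fin (s k)).sum_comp, Fintype.sum_prod_type_right]
  rfl

lemma sum_norm_ttProd_sq_le {s : Fin d → ℕ} (G : ∀ k, Core R (s k)) (hG : ∀ k, ‖G k‖ ≤ 1)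
    (v : EuclideanSpace ℝ (Fin R)) : ∑ i, ‖ttProd G i v‖ ^ 2 ≤ ‖v‖ ^ 2 := by
  induction d with
  | zero => simp
  | succ d ih =>
    rw [sum_fin_succ_pi]
    refine le_trans (Finset.sum_le_sum fun j _ => ?_)
      (ih (fun k => G k.succ) fun k => hG k.succ)
    simp only [ttProd_succ, Fin.cons_zero, Fin.cons_succ]
    rw [← PiLp.norm_sq_eq_of_L2]
    gcongr
    simpa using (G 0).le_of_opNorm_le (hG 0) _

/-- The tensor with entries `⟨e, G₁(i₁) ⋯ G_d(i_d) e⟩`, as a multilinear function of the cores. -/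
noncomputable def ttMap (s : Fin d → ℕ) (e : EuclideanSpace ℝ (Fin R)) :
    MultilinearMap ℝ (fun k => Core R (s k)) (Tensor s) :=
  (WithLp.linearEquiv 2 ℝ ((∀ k, Fin (s k)) → ℝ)).symm.toLinearMap.compMultilinearMap
    (MultilinearMap.pi fun i =>
      ((innerₛₗ ℝ e).comp (LinearMap.applyₗ e)).compMultilinearMap
        ((MultilinearMap.mkPiAlgebraFin ℝ d (Module.End ℝ (EuclideanSpace ℝ (Fin R)))).compLinearMap
          fun k => coreSlice (i k)))

lemma ttMap_apply (s : Fin d → ℕ) (e : EuclideanSpace ℝ (Fin R)) (G : ∀ k, Core R (s k))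
    (i : ∀ k, Fin (s k)) : ttMap s e G i = inner ℝ e (ttProd G i e) := by
  simp [ttMap, ttProd]

lemma norm_ttMap_le_one (s : Fin d → ℕ) {e : EuclideanSpace ℝ (Fin R)} (he : ‖e‖ = 1)
    (G : ∀ k, Core R (s k)) (hG : ∀ k, ‖G k‖ ≤ 1) : ‖ttMap s e G‖ ≤ 1 := by
  have h : ‖ttMap s e G‖ ^ 2 ≤ 1 := by
    rw [EuclideanSpace.norm_sq_eq]
    calc ∑ i, ‖ttMap s e G i‖ ^ 2 ≤ ∑ i, ‖ttProd G i e‖ ^ 2 := by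
          refine Finset.sum_le_sum fun i _ => ?_
          gcongr
          rw [ttMap_apply]
          simpa [he] using norm_inner_le_norm (𝕜 := ℝ) e (ttProd G i e)
      _ ≤ 1 := by simpa [he] using sum_norm_ttProd_sq_le G hG e
  exact (sq_le_one_iff₀ (norm_nonneg _)).1 h

/-- The separation of a (vector-valued) array after its first `k` modes into `R` terms: a
rank-`R` factorization of the `k`-th sequential matricization in which the left factor depends on
the first `k` indices only and the right factor on the others. -/
def SplitsAt {d : ℕ} {s : Fin d → ℕ} {H : Type*} [AddCommGroup H] [Module ℝ H]
    (A : (∀ k, Fin (s k)) → H) (R k : ℕ) : Prop :=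
  ∃ (a : (∀ k, Fin (s k)) → Fin R → H) (b : (∀ k, Fin (s k)) → Fin R → ℝ),
    (∀ i i', (∀ j : Fin d, (j : ℕ) < k → i j = i' j) → a i = a i') ∧
    (∀ i i', (∀ j : Fin d, k ≤ (j : ℕ) → i j = i' j) → b i = b i') ∧
    ∀ i, A i = ∑ β, b i β • a i β

/-- Tensor train decomposition with contractive cores, for arrays with values in the bond space.
The first core spans the columns of the first matricization, and the array of coordinates of the
other modes inherits the separations. -/
lemma exists_cores_vector {e : EuclideanSpace ℝ (Fin R)} (he : ‖e‖ = 1) {s : Fin (d + 1) → ℕ}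
    (hs : ∀ k, 0 < s k) (A : (∀ k, Fin (s k)) → EuclideanSpace ℝ (Fin R))
    (hA : ∑ i, ‖A i‖ ^ 2 ≤ 1) (hsplit : ∀ k, 1 ≤ k → k ≤ d → SplitsAt A R k) :
    ∃ G : ∀ k, Core R (s k), (∀ k, ‖G k‖ ≤ 1) ∧ ∀ i, A i = ttProd G i e := by
  induction d with
  | zero =>
    let a : PiLp 2 fun _ : Fin (s 0) => EuclideanSpace ℝ (Fin R) :=
      WithLp.toLp 2 fun i₀ => A (Fin.cons i₀ fun k => k.elim0)
    have ha : ‖a‖ ≤ 1 := by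
      rw [sum_fin_succ_pi] at hA
      refine (sq_le_one_iff₀ (norm_nonneg _)).1 ?_
      rw [PiLp.norm_sq_eq_of_L2]
      refine le_trans (le_of_eq ?_) hA
      have hu : ∀ f : (∀ k : Fin 0, Fin (s k.succ)) → ℝ, ∑ j, f j = f fun k => k.elim0 := fun f =>
        (Fintype.sum_unique f).trans (congrArg f (funext fun k => k.elim0))
      rw [hu]
    obtain ⟨g, hg, hge⟩ := exists_continuousLinearMap_apply_eq he a
    refine ⟨Fin.cons g fun k => k.elim0, Fin.cases (hg.trans ha) fun k => k.elim0, fun i => ?_⟩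
    rw [ttProd_succ, ttProd_zero, Fin.cons_zero, Module.End.one_apply, hge]
    exact congrArg A (funext (Fin.cases rfl fun k => k.elim0))
  | succ d ih =>
    -- `X j` collects the entries whose indices after the first are `j`
    let X : (∀ k : Fin (d + 1), Fin (s k.succ)) →
        PiLp 2 fun _ : Fin (s 0) => EuclideanSpace ℝ (Fin R) :=
      fun j => WithLp.toLp 2 fun i₀ => A (Fin.cons i₀ j)
    have hXA : ∀ i, A i = X (fun k => i k.succ) (i 0) := fun i => by
      simp only [X]
      congr 1
      exact (Fin.cons_self_tail i).symm
    obtain ⟨U, P, hU, hP, hUP⟩ : ∃ (U : Core R (s 0))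
        (P : (PiLp 2 fun _ : Fin (s 0) => EuclideanSpace ℝ (Fin R)) →L[ℝ]
          EuclideanSpace ℝ (Fin R)), ‖U‖ ≤ 1 ∧ ‖P‖ ≤ 1 ∧ ∀ j, U (P (X j)) = X j := by
      obtain ⟨a, b, ha, hb, hab⟩ := hsplit 1 le_rfl (by omega)
      let j₀ : ∀ k : Fin (d + 1), Fin (s k.succ) := fun k => ⟨0, hs _⟩
      let col : Fin R → PiLp 2 fun _ : Fin (s 0) => EuclideanSpace ℝ (Fin R) :=
        fun β => WithLp.toLp 2 fun i₀ => a (Fin.cons i₀ j₀) β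
      obtain ⟨U, P, hU, hP, hUP⟩ :=
        (Submodule.span ℝ (Set.range col)).exists_contraction_section
          (R := R) ((finrank_range_le_card col).trans_eq (Fintype.card_fin R))
      refine ⟨U, P, hU, hP, fun j => hUP _ ?_⟩
      let i₀' : Fin (s 0) := ⟨0, hs 0⟩
      have hX : X j = ∑ β, b (Fin.cons i₀' j) β • col β := by
        ext1 i₀
        simp only [X, col, WithLp.ofLp_sum, WithLp.ofLp_smul, Finset.sum_apply, Pi.smul_apply]
        rw [hab]
        refine Finset.sum_congr rfl fun β _ => ?_
        rw [ha (Fin.cons i₀ j) (Fin.cons i₀ j₀), hb (Fin.cons i₀ j) (Fin.cons i₀' j)]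
        · intro k hk
          obtain ⟨k, rfl⟩ := Fin.exists_succ_eq.2 (show k ≠ 0 by rintro rfl; simp at hk)
          simp
        · intro k hk
          obtain rfl : k = 0 := Fin.ext (by simpa using hk)
          simp
      rw [hX]
      exact Submodule.sum_mem _ fun β _ =>
        Submodule.smul_mem _ _ (Submodule.subset_span ⟨β, rfl⟩)
    obtain ⟨G, hG, hB⟩ := ih (fun k => hs k.succ) (fun j => P (X j)) (by
      rw [sum_fin_succ_pi] at hA
      refine le_trans (Finset.sum_le_sum fun j _ => ?_) hA
      have h1 : ‖P (X j)‖ ≤ ‖X j‖ := by simpa using P.le_of_opNorm_le hP (X j)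
      calc ‖P (X j)‖ ^ 2 ≤ ‖X j‖ ^ 2 := by gcongr
        _ = _ := PiLp.norm_sq_eq_of_L2 _ _) (by
      intro k hk1 hk2
      obtain ⟨a, b, ha, hb, hab⟩ := hsplit (k + 1) (by omega) (by omega)
      let i₀' : Fin (s 0) := ⟨0, hs 0⟩
      refine ⟨fun j β => P (WithLp.toLp 2 fun i₀ => a (Fin.cons i₀ j) β),
        fun j => b (Fin.cons i₀' j), ?_, ?_, ?_⟩
      · intro j j' hjj'
        funext β
        have h : ∀ i₀ : Fin (s 0), a (Fin.cons i₀ j) = a (Fin.cons i₀ j') := fun i₀ => by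
          refine ha _ _ ?_
          refine Fin.cases (by simp) fun l hl => ?_
          simpa using hjj' l (by simpa using hl)
        simp only [h]
      · intro j j' hjj'
        refine hb _ _ (Fin.cases (by simp) fun l hl => ?_)
        simpa using hjj' l (by simpa using hl)
      · intro j
        have hX : X j = ∑ β, b (Fin.cons i₀' j) β •
            (WithLp.toLp 2 fun i₀ => a (Fin.cons i₀ j) β :
              PiLp 2 fun _ : Fin (s 0) => EuclideanSpace ℝ (Fin R)) := by
          ext1 i₀
          simp only [X, WithLp.ofLp_sum, WithLp.ofLp_smul, Finset.sum_apply, Pi.smul_apply]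
          rw [hab]
          refine Finset.sum_congr rfl fun β _ => ?_
          rw [hb (Fin.cons i₀ j) (Fin.cons i₀' j)]
          refine Fin.cases (by simp) fun l _ => by simp
        simp only [hX, map_sum, map_smul])
    refine ⟨Fin.cons U G, Fin.cases hU hG, fun i => ?_⟩
    rw [ttProd_succ, hXA, ← hUP, hB]
    rfl

/-- A tensor of norm at most one all of whose sequential matricizations have rank at most `R` is
a tensor train with contractive cores of bond dimension `R`. -/
lemma exists_cores {e : EuclideanSpace ℝ (Fin R)} (he : ‖e‖ = 1) (hd : 1 ≤ d) {s : Fin d → ℕ}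
    (hs : ∀ k, 0 < s k) (A : Tensor s) (hA : ‖A‖ ≤ 1)
    (hsplit : ∀ k, 1 ≤ k → k < d → SplitsAt (fun i => A i) R k) :
    ∃ G : ∀ k, Core R (s k), (∀ k, ‖G k‖ ≤ 1) ∧ A = ttMap s e G := by
  obtain ⟨d, rfl⟩ : ∃ d', d = d' + 1 := ⟨d - 1, by omega⟩
  obtain ⟨G, hG, hGA⟩ := exists_cores_vector he hs (fun i => A i • e) (by
    have : ‖A‖ ^ 2 ≤ 1 := (sq_le_one_iff₀ (norm_nonneg _)).2 hA
    rw [EuclideanSpace.norm_sq_eq] at this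
    simpa [norm_smul, he] using this) (by
    intro k hk1 hk2
    obtain ⟨a, b, ha, hb, hab⟩ := hsplit k hk1 (by omega)
    refine ⟨fun i β => a i β • e, b, fun i i' h => ?_, hb, fun i => ?_⟩
    · simp only [ha i i' h]
    · simp only [hab, Finset.sum_smul, smul_smul, smul_eq_mul])
  refine ⟨G, hG, ?_⟩
  ext i
  rw [ttMap_apply, ← hGA, inner_smul_right, real_inner_self_eq_norm_sq, he]
  simp

end TTReg

/-! ### Differences of tensors of bounded tensor train ranks -/

lemma Matrix.rank_sub_le_add {a b : Type*} [Fintype a] [Fintype b] (M N : Matrix a b ℝ) :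
    (M - N).rank ≤ M.rank + N.rank := by
  have h : LinearMap.range (M - N).mulVecLin ≤
      LinearMap.range M.mulVecLin ⊔ LinearMap.range N.mulVecLin := by
    rintro _ ⟨v, rfl⟩
    rw [Matrix.mulVecLin_apply, Matrix.sub_mulVec]
    exact Submodule.sub_mem _ (Submodule.mem_sup_left ⟨v, rfl⟩) (Submodule.mem_sup_right ⟨v, rfl⟩)
  exact (Submodule.finrank_mono h).trans (Submodule.finrank_add_le_finrank_add_finrank _ _)

lemma Matrix.rank_smul_le_rank {a b : Type*} [Fintype b] (c : ℝ) (M : Matrix a b ℝ) :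
    (c • M).rank ≤ M.rank := by
  classical
  have h : c • M = M * (c • (1 : Matrix b b ℝ)) := by rw [Matrix.mul_smul, Matrix.mul_one]
  rw [h]
  exact Matrix.rank_mul_le_left _ _

namespace TTReg

variable {n m : ℕ} {q : Fin n → ℕ} {p : Fin m → ℕ} {R : ℕ}

/-- The dimensions of the `n` response modes followed by those of the `m` predictor modes. -/
def modeDim (q : Fin n → ℕ) (p : Fin m → ℕ) (k : Fin (n + m)) : ℕ :=
  Sum.elim q p (finSumFinEquiv.symm k)

/-- Multi-indices of coefficient tensors, with the modes in a single sequence. -/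
def idxEquiv (q : Fin n → ℕ) (p : Fin m → ℕ) :
    (∀ k : Fin n ⊕ Fin m, Fin (Sum.elim q p k)) ≃ ∀ k : Fin (n + m), Fin (modeDim q p k) :=
  Equiv.piCongrLeft' (fun k => Fin (Sum.elim q p k)) finSumFinEquiv

lemma idxEquiv_apply (u : ∀ k : Fin n ⊕ Fin m, Fin (Sum.elim q p k)) (k : Fin (n + m)) :
    idxEquiv q p u k = u (finSumFinEquiv.symm k) := rfl

lemma apply_eq_of_idxEquiv_apply_eq {u u' : ∀ k : Fin n ⊕ Fin m, Fin (Sum.elim q p k)}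
    (k : Fin n ⊕ Fin m)
    (h : idxEquiv q p u (finSumFinEquiv k) = idxEquiv q p u' (finSumFinEquiv k)) : u k = u' k := by
  simp only [idxEquiv_apply] at h
  have key : ∀ k', k' = k → u k' = u' k' → u k = u' k := by
    rintro k' rfl h
    exact h
  exact key _ (finSumFinEquiv.symm_apply_apply k) h

/-- Reindexing of coefficient tensors by a single sequence of modes. -/
noncomputable def coefEquiv (q : Fin n → ℕ) (p : Fin m → ℕ) :
    Coef q p ≃ₗᵢ[ℝ] Tensor (modeDim q p) :=
  LinearIsometryEquiv.piLpCongrLeft 2 ℝ ℝ (idxEquiv q p)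

lemma coefEquiv_apply (A : Coef q p) (i : ∀ k, Fin (modeDim q p k)) :
    coefEquiv q p A i = A ((idxEquiv q p).symm i) := rfl

/-- The coefficient tensor of a train of cores, as a multilinear function of the cores. -/
noncomputable def coefMap (q : Fin n → ℕ) (p : Fin m → ℕ) (e : EuclideanSpace ℝ (Fin R)) :
    MultilinearMap ℝ (fun k => Core R (modeDim q p k)) (Coef q p) :=
  (coefEquiv q p).symm.toLinearEquiv.toLinearMap.compMultilinearMap (ttMap (modeDim q p) e)

lemma coefMap_apply (e : EuclideanSpace ℝ (Fin R)) (G : ∀ k, Core R (modeDim q p k)) :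
    coefMap q p e G = (coefEquiv q p).symm (ttMap (modeDim q p) e G) := rfl

lemma norm_coefMap_le_one {e : EuclideanSpace ℝ (Fin R)} (he : ‖e‖ = 1)
    (G : ∀ k, Core R (modeDim q p k)) (hG : ∀ k, ‖G k‖ ≤ 1) : ‖coefMap q p e G‖ ≤ 1 := by
  rw [coefMap_apply, LinearIsometryEquiv.norm_map]
  exact norm_ttMap_le_one _ he G hG

lemma apply_eq_seqMat (A : Coef q p) (i : ℕ) (u : ∀ k : Fin n ⊕ Fin m, Fin (Sum.elim q p k)) :
    A u = seqMat A i (fun k => u k) (fun k => u k) := by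
  simp [seqMat]

lemma seqMat_sub (A B : Coef q p) (i : ℕ) : seqMat (A - B) i = seqMat A i - seqMat B i := by
  ext; simp [seqMat]

lemma seqMat_smul (c : ℝ) (A : Coef q p) (i : ℕ) : seqMat (c • A) i = c • seqMat A i := by
  ext; simp [seqMat]

lemma splitsAt_of_rank_le (A : Coef q p) {k : ℕ} (h : (seqMat A k).rank ≤ R) :
    SplitsAt (fun i => coefEquiv q p A i) R k := by
  obtain ⟨P, Q, hPQ⟩ := (seqMat A k).exists_factorization_of_rank_le h
  refine ⟨fun i β => P (fun l => (idxEquiv q p).symm i l) β,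
    fun i β => Q β (fun l => (idxEquiv q p).symm i l), ?_, ?_, fun i => ?_⟩
  · intro i i' hii'
    have h1 : (fun l : {l : Fin n ⊕ Fin m // pos l < k} => (idxEquiv q p).symm i l.1)
        = fun l : {l : Fin n ⊕ Fin m // pos l < k} => (idxEquiv q p).symm i' l.1 := by
      funext l
      refine apply_eq_of_idxEquiv_apply_eq _ ?_
      simpa using hii' _ l.2
    simp only [h1]
  · intro i i' hii'
    have h1 : (fun l : {l : Fin n ⊕ Fin m // ¬ pos l < k} => (idxEquiv q p).symm i l.1)
        = fun l : {l : Fin n ⊕ Fin m // ¬ pos l < k} => (idxEquiv q p).symm i' l.1 := by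
      funext l
      refine apply_eq_of_idxEquiv_apply_eq _ ?_
      simpa using hii' _ (not_lt.1 l.2)
    simp only [h1]
  · simp only [coefEquiv_apply, smul_eq_mul]
    rw [apply_eq_seqMat A k, hPQ]

/-- A difference of two tensors of tensor train ranks at most `r`, scaled into the unit ball, is a
tensor train with contractive cores of bond dimension `2 r_max`. -/
lemma exists_coefMap_eq_smul_sub (hn : 1 ≤ n) (hq : ∀ a, 0 < q a) (hp : ∀ b, 0 < p b)
    {r : Fin (n + m - 1) → ℕ} {e : EuclideanSpace ℝ (Fin (2 * rMax r))} (he : ‖e‖ = 1)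
    {A B : Coef q p} (hA : A ∈ ttSet q p r) (hB : B ∈ ttSet q p r) {c : ℝ}
    (hAB : ‖c • (A - B)‖ ≤ 1) :
    ∃ G : ∀ k, Core (2 * rMax r) (modeDim q p k), (∀ k, ‖G k‖ ≤ 1) ∧
      c • (A - B) = coefMap q p e G := by
  have hs : ∀ k, 0 < modeDim q p k := fun k => by
    unfold modeDim
    rcases finSumFinEquiv.symm k with a | b
    · exact hq a
    · exact hp b
  obtain ⟨G, hG, hGA⟩ := exists_cores he (by omega) hs (coefEquiv q p (c • (A - B)))
    (((coefEquiv q p).norm_map _).trans_le hAB) (by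
      intro k hk1 hk2
      refine splitsAt_of_rank_le _ ?_
      let k' : Fin (n + m - 1) := ⟨k - 1, by omega⟩
      have hk' : (k' : ℕ) + 1 = k := Nat.sub_add_cancel hk1
      have h1 := hA k'
      have h2 := hB k'
      have h3 : r k' ≤ rMax r := Finset.le_sup (Finset.mem_univ k')
      rw [hk'] at h1 h2
      rw [seqMat_smul, seqMat_sub]
      refine (Matrix.rank_smul_le_rank _ _).trans ((Matrix.rank_sub_le_add _ _).trans ?_)
      omega)
  refine ⟨G, hG, ?_⟩
  rw [coefMap_apply, ← hGA, LinearIsometryEquiv.symm_apply_apply]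

/-- Nets of the unit balls of the cores of all modes; the logarithm of the number of trains
formed from them is linear in the model complexity. -/
lemma exists_core_nets (q : Fin n → ℕ) (p : Fin m → ℕ) (r : Fin (n + m - 1) → ℕ) {ε : ℝ}
    (hε : 0 < ε) (hε1 : ε ≤ 1) :
    ∃ S : ∀ k, Finset (Core (2 * rMax r) (modeDim q p k)), (∀ k, ∀ c ∈ S k, ‖c‖ ≤ 1) ∧
      (∀ k, ∀ x, ‖x‖ ≤ 1 → ∃ c ∈ S k, ‖x - c‖ ≤ ε) ∧
      ((Fintype.piFinset S).card : ℝ) ≤ Real.exp (Real.log (3 / ε) * dLR q p r) := by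
  choose S h1 h2 h3 using fun k => exists_net_unitBall (Core (2 * rMax r) (modeDim q p k)) hε hε1
  refine ⟨S, h1, h2, ?_⟩
  have hpos : 0 < 3 / ε := by positivity
  have hlog : 0 ≤ Real.log (3 / ε) := Real.log_nonneg (by rw [le_div_iff₀ hε]; linarith)
  have hsum : ∑ k : Fin (n + m), modeDim q p k = ∑ a, q a + ∑ b, p b := by
    rw [← finSumFinEquiv.sum_comp, Fintype.sum_sum_type]
    simp [modeDim]
  calc ((Fintype.piFinset S).card : ℝ) = ∏ k, ((S k).card : ℝ) := by
        rw [Fintype.card_piFinset]; push_cast; rfl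
    _ ≤ ∏ k, (3 / ε) ^ Module.finrank ℝ (Core (2 * rMax r) (modeDim q p k)) :=
        Finset.prod_le_prod (fun _ _ => by positivity) fun k _ => h3 k
    _ = (3 / ε) ^ (4 * rMax r ^ 2 * (∑ b, p b + ∑ a, q a)) := by
        rw [Finset.prod_pow_eq_pow_sum, add_comm (∑ b, p b), ← hsum, Finset.mul_sum]
        congr 1
        refine Finset.sum_congr rfl fun k _ => ?_
        rw [finrank_core]
        ring
    _ = Real.exp (Real.log (3 / ε) *
          (4 * (rMax r : ℝ) ^ 2 * (∑ b, (p b : ℝ) + ∑ a, (q a : ℝ)))) := by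
        rw [← Real.rpow_natCast, Real.rpow_def_of_pos hpos]
        push_cast
        rfl
    _ ≤ _ := by
        gcongr
        unfold dLR
        have : (0 : ℝ) ≤ 2 * (rMax r : ℝ) := by positivity
        linarith

/-- Passage from nets to the whole set: a linear map that distorts the norms of the trains of
net points by factors between `lo` and `hi` does so, up to the resolution of the nets, on
all trains of contractive cores of norm one. -/
lemma norm_linearMap_coefMap_bounds (hn : 1 ≤ n) {H : Type*} [NormedAddCommGroup H]
    [NormedSpace ℝ H] (Φ : Coef q p →ₗ[ℝ] H) {e : EuclideanSpace ℝ (Fin R)} (he : ‖e‖ = 1)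
    {ε lo hi : ℝ} (hε : 0 < ε) (hεn : ((n : ℝ) + m) * ε ≤ 1 / 2) (hlo : 0 ≤ lo) (hhi : 0 ≤ hi)
    (S : ∀ k, Finset (Core R (modeDim q p k))) (hS : ∀ k, ∀ c ∈ S k, ‖c‖ ≤ 1)
    (hnet : ∀ k, ∀ x, ‖x‖ ≤ 1 → ∃ c ∈ S k, ‖x - c‖ ≤ ε)
    (hSlo : ∀ G ∈ Fintype.piFinset S, lo * ‖coefMap q p e G‖ ≤ ‖Φ (coefMap q p e G)‖)
    (hShi : ∀ G ∈ Fintype.piFinset S, ‖Φ (coefMap q p e G)‖ ≤ hi * ‖coefMap q p e G‖)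
    (G : ∀ k, Core R (modeDim q p k)) (hG : ∀ k, ‖G k‖ ≤ 1) :
    ‖Φ (coefMap q p e G)‖ ≤ 2 * hi ∧
      (‖coefMap q p e G‖ = 1 →
        lo * (1 - (n + m) * ε) - (n + m) * ε * (2 * hi) ≤ ‖Φ (coefMap q p e G)‖) := by
  have : Nonempty (Fin (n + m)) := ⟨⟨0, by omega⟩⟩
  have hcard : (Fintype.card (Fin (n + m)) : ℝ) = n + m := by simp
  have hadd : ∀ x y, ‖Φ (x + y)‖ ≤ ‖Φ x‖ + ‖Φ y‖ := fun x y => by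
    rw [map_add]; exact norm_add_le _ _
  have hsmul : ∀ (c : ℝ) (x), 0 ≤ c → ‖Φ (c • x)‖ = c * ‖Φ x‖ := fun c x hc => by
    rw [map_smul, norm_smul, Real.norm_of_nonneg hc]
  have hup : ∀ G : ∀ k, Core R (modeDim q p k), (∀ k, ‖G k‖ ≤ 1) →
      ‖Φ (coefMap q p e G)‖ ≤ 2 * hi := by
    refine (coefMap q p e).sublinear_le_of_net (fun x => ‖Φ x‖) hadd hsmul hε
      (C := ‖LinearMap.toContinuousLinearMap Φ‖) (by rw [hcard]; exact hεn) ?_ S hS hnet ?_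
    · intro G hG
      have := (LinearMap.toContinuousLinearMap Φ).le_opNorm (coefMap q p e G)
      exact this.trans (mul_le_of_le_one_right (norm_nonneg _) (norm_coefMap_le_one he G hG))
    · intro G hG
      exact (hShi G (Fintype.mem_piFinset.2 hG)).trans
        (mul_le_of_le_one_right hhi (norm_coefMap_le_one he G fun k => hS k _ (hG k)))
  refine ⟨hup G hG, fun h1 => ?_⟩
  choose c hcS hc using fun k => hnet k (G k) (hG k)
  have hcb : ∀ k, ‖c k‖ ≤ 1 := fun k => hS k _ (hcS k)
  have hd1 := (coefMap q p e).sublinear_sub_le (fun x => ‖Φ x‖) hadd hsmul hε hup G c hG hcb hc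
  have hd2 := (coefMap q p e).sublinear_sub_le (fun x => ‖x‖) norm_add_le
    (fun c x hc => by rw [norm_smul, Real.norm_of_nonneg hc]) hε
    (fun G hG => norm_coefMap_le_one he G hG) G c hG hcb hc
  rw [hcard] at hd1 hd2
  rw [map_sub] at hd1
  have h2 := hSlo c (Fintype.mem_piFinset.2 hcS)
  have h3 := norm_sub_norm_le (coefMap q p e G) (coefMap q p e c)
  have h4 := norm_sub_norm_le (Φ (coefMap q p e c)) (Φ (coefMap q p e G))
  rw [norm_sub_rev] at h4
  have h5 : lo * (1 - (n + m) * ε) ≤ lo * ‖coefMap q p e c‖ := by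
    gcongr
    linarith
  linarith

end TTReg

namespace TTReg

variable {n m : ℕ} {q : Fin n → ℕ} {p : Fin m → ℕ} {N : ℕ}

/-! ### Deterministic analysis of the least squares problem -/

/-- Lower semicontinuity of the rank makes the constraint set of the least squares problem
closed. -/
lemma isClosed_ttSet (q : Fin n → ℕ) (p : Fin m → ℕ) (r : Fin (n + m - 1) → ℕ) :
    IsClosed (ttSet q p r) := by
  have h : ttSet q p r = ⋂ k, {A | (seqMat A (k.val + 1)).rank ≤ r k} := by
    ext A; simp [ttSet]
  rw [h]
  refine isClosed_iInter fun k => ?_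
  let f : Coef q p →ₗ[ℝ]
      (((l : {l : Fin n ⊕ Fin m // ¬ pos l < k.val + 1}) → Fin (Sum.elim q p l)) → ℝ) →L[ℝ]
      (((l : {l : Fin n ⊕ Fin m // pos l < k.val + 1}) → Fin (Sum.elim q p l)) → ℝ) :=
    { toFun := fun A => LinearMap.toContinuousLinearMap (seqMat A (k.val + 1)).mulVecLin
      map_add' := fun A B => by
        ext v i
        simp [seqMat, Matrix.mulVec, dotProduct, add_mul, Finset.sum_add_distrib]
      map_smul' := fun c A => by
        ext v i
        simp [seqMat, Matrix.mulVec, dotProduct, mul_assoc, Finset.mul_sum] }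
  have hf : Continuous f := f.continuous_of_finiteDimensional
  have hc : {A : Coef q p | (seqMat A (k.val + 1)).rank ≤ r k}
      = (f ⁻¹' {g | ((r k + 1 : ℕ) : Cardinal) ≤ g.toLinearMap.rank})ᶜ := by
    ext A
    have h1 : (f A).toLinearMap = (seqMat A (k.val + 1)).mulVecLin := rfl
    have h2 : ((seqMat A (k.val + 1)).rank : Cardinal) = (seqMat A (k.val + 1)).mulVecLin.rank :=
      Module.finrank_eq_rank _ _
    simp only [Set.mem_ofPred_eq, Set.mem_compl_iff, Set.mem_preimage, h1, ← h2, Nat.cast_le]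
    omega
  rw [hc, isClosed_compl_iff]
  exact (isOpen_setOfPred_nat_le_rank _).preimage hf

/-- The linear map that sends a coefficient tensor to the family of its contractions with the
predictors. -/
noncomputable def designMap (X : Fin N → Tensor p) :
    Coef q p →ₗ[ℝ] PiLp 2 fun _ : Fin N => Tensor q where
  toFun A := WithLp.toLp 2 fun i => contract A (X i)
  map_add' A B := by
    ext i j
    simp [contract, add_mul, Finset.sum_add_distrib]
  map_smul' c A := by
    ext i j
    simp [contract, mul_assoc, Finset.mul_sum]

lemma designMap_apply (X : Fin N → Tensor p) (A : Coef q p) (i : Fin N) :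
    designMap X A i = contract A (X i) := rfl

lemma rss_eq_norm_sq (X : Fin N → Tensor p) (E Y : Fin N → Tensor q) (A₀ A : Coef q p)
    (hY : ∀ i, Y i = contract A₀ (X i) + E i) :
    rss Y X A = ‖(WithLp.toLp 2 E : PiLp 2 fun _ : Fin N => Tensor q)
      - designMap X (A - A₀)‖ ^ 2 := by
  rw [PiLp.norm_sq_eq_of_L2, rss]
  refine Finset.sum_congr rfl fun i _ => ?_
  rw [map_sub, hY]
  simp only [WithLp.ofLp_sub, Pi.sub_apply, designMap_apply]
  congr 2
  abel

/-- The basic inequality of least squares: restricted strong convexity with constant `a` and a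
bound `s` on the noise, both on the differences from the true parameter, bound the error of every
solution, and restricted strong convexity makes the problem solvable. -/
lemma leastSquares_exists_and_error_le {V H : Type*} [NormedAddCommGroup V] [NormedSpace ℝ V]
    [FiniteDimensional ℝ V] [NormedAddCommGroup H] [InnerProductSpace ℝ H] {C : Set V}
    (hC : IsClosed C) (Φ : V →ₗ[ℝ] H) (e : H) {x₀ : V} (hx₀ : x₀ ∈ C) {a s : ℝ} (ha : 0 < a)
    (hs : 0 ≤ s) (hrsc : ∀ x ∈ C, a * ‖x - x₀‖ ^ 2 ≤ ‖Φ (x - x₀)‖ ^ 2)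
    (hnoise : ∀ x ∈ C, inner ℝ e (Φ (x - x₀)) ≤ s * ‖x - x₀‖) :
    (∃ x ∈ C, ∀ y ∈ C, ‖e - Φ (x - x₀)‖ ^ 2 ≤ ‖e - Φ (y - x₀)‖ ^ 2) ∧
      ∀ x ∈ C, ‖e - Φ (x - x₀)‖ ^ 2 ≤ ‖e - Φ (x₀ - x₀)‖ ^ 2 → ‖x - x₀‖ ≤ 2 * s / a := by
  have : ProperSpace V := FiniteDimensional.proper ℝ V
  constructor
  · have hsa : 0 < √a := Real.sqrt_pos.2 ha
    have hΦ : Continuous Φ := LinearMap.continuous_of_finiteDimensional _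
    obtain ⟨x, hx, hmin⟩ := ((isCompact_closedBall x₀ (2 * ‖e‖ / √a)).inter_left
      hC).exists_isMinOn (f := fun x => ‖e - Φ (x - x₀)‖ ^ 2)
      ⟨x₀, hx₀, Metric.mem_closedBall_self (by positivity)⟩
      (Continuous.continuousOn (by fun_prop))
    refine ⟨x, hx.1, fun y hy => ?_⟩
    by_cases hyb : y ∈ Metric.closedBall x₀ (2 * ‖e‖ / √a)
    · exact hmin ⟨hy, hyb⟩
    -- outside the ball the fit is worse than that of the true parameter
    · refine (hmin ⟨hx₀, Metric.mem_closedBall_self (by positivity)⟩ :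
        ‖e - Φ (x - x₀)‖ ^ 2 ≤ ‖e - Φ (x₀ - x₀)‖ ^ 2).trans ?_
      simp only [sub_self, map_zero, sub_zero]
      have h1 : 2 * ‖e‖ / √a < ‖y - x₀‖ := by
        rw [← dist_eq_norm]; simpa using hyb
      have h2 : √a * ‖y - x₀‖ ≤ ‖Φ (y - x₀)‖ := by
        refine (sq_le_sq₀ (by positivity) (by positivity)).1 ?_
        rw [mul_pow, Real.sq_sqrt ha.le]
        exact hrsc y hy
      have h3 := norm_sub_norm_le (Φ (y - x₀)) e
      rw [norm_sub_rev] at h3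
      rw [div_lt_iff₀ hsa] at h1
      gcongr
      linarith
  · intro x hx h1
    rw [sub_self, map_zero, sub_zero, norm_sub_sq_real] at h1
    have h2 := hrsc x hx
    have h3 := hnoise x hx
    rcases (norm_nonneg (x - x₀)).eq_or_lt with h0 | h0
    · rw [← h0]
      positivity
    · rw [le_div_iff₀ ha]
      refine le_of_mul_le_mul_left ?_ h0
      nlinarith

end TTReg

/-! ### Squares of sub-Gaussian random variables -/

lemma Real.exp_le_one_add_add_sq_mul_exp_abs (x : ℝ) :
    Real.exp x ≤ 1 + x + x ^ 2 * Real.exp |x| := by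
  have h := Complex.norm_exp_sub_sum_le_norm_mul_exp (x : ℂ) 2
  have h1 : Complex.exp x - ∑ m ∈ Finset.range 2, (x : ℂ) ^ m / (m.factorial : ℂ)
      = ((Real.exp x - (1 + x) : ℝ) : ℂ) := by
    simp [Finset.sum_range_succ]
  rw [h1, Complex.norm_real, Complex.norm_real, Real.norm_eq_abs, Real.norm_eq_abs, sq_abs] at h
  linarith [le_abs_self (Real.exp x - (1 + x))]

/-- The exact value is `√2`. -/
lemma lintegral_exp_sq_div_four_gaussianReal_le :
    ∫⁻ g, ENNReal.ofReal (Real.exp (g ^ 2 / 4)) ∂(gaussianReal 0 1) ≤ 2 := by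
  rw [gaussianReal_of_var_ne_zero _ one_ne_zero, lintegral_withDensity_eq_lintegral_mul _
    (measurable_gaussianPDF _ _) (by fun_prop)]
  have h : ∀ x : ℝ, (gaussianPDF 0 1 * fun g => ENNReal.ofReal (Real.exp (g ^ 2 / 4))) x
      = ENNReal.ofReal ((√(2 * Real.pi))⁻¹ * Real.exp (-(1 / 4) * x ^ 2)) := fun x => by
    simp only [Pi.mul_apply, gaussianPDF, gaussianPDFReal]
    rw [← ENNReal.ofReal_mul (by positivity), mul_assoc, ← Real.exp_add]
    simp only [NNReal.coe_one, mul_one, sub_zero]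
    congr 3
    ring
  simp_rw [h]
  rw [← ofReal_integral_eq_lintegral_ofReal
    ((integrable_exp_neg_mul_sq (by norm_num)).const_mul _)
    (Filter.Eventually.of_forall fun x => by positivity), integral_const_mul, integral_gaussian]
  rw [ENNReal.ofReal_le_iff_le_toReal (by simp), ENNReal.toReal_ofNat,
    inv_mul_le_iff₀ (by positivity), Real.sqrt_le_left (by positivity), mul_pow,
    Real.sq_sqrt (by positivity)]
  nlinarith [Real.pi_pos]

section SubGaussianSquare

variable {Ω : Type*} [MeasurableSpace Ω] {μ : Measure Ω} [IsProbabilityMeasure μ]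

/-- The square of a sub-Gaussian variable has an exponential moment. It is computed by writing
`exp (z² / (4 s))` as an average of `exp (t z)` over Gaussian `t`. -/
lemma ProbabilityTheory.HasSubgaussianMGF.lintegral_exp_sq_le {Z : Ω → ℝ} {s : ℝ≥0}
    (hZ : HasSubgaussianMGF Z s μ) (hZm : Measurable Z) (hs : 0 < s) :
    ∫⁻ ω, ENNReal.ofReal (Real.exp (Z ω ^ 2 / (4 * s))) ∂μ ≤ 2 := by
  have hs' : (0 : ℝ) < s := hs
  set t : ℝ := √(1 / (2 * s)) with ht
  have ht2 : t ^ 2 = 1 / (2 * s) := Real.sq_sqrt (by positivity)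
  have h1 : ∀ z : ℝ, ENNReal.ofReal (Real.exp (z ^ 2 / (4 * s)))
      = ∫⁻ g, ENNReal.ofReal (Real.exp (t * z * g)) ∂(gaussianReal 0 1) := fun z => by
    rw [← ofReal_integral_eq_lintegral_ofReal (integrable_exp_mul_gaussianReal _)
      (Filter.Eventually.of_forall fun x => (Real.exp_pos _).le)]
    have := congrFun (mgf_fun_id_gaussianReal (μ := 0) (v := 1)) (t * z)
    rw [mgf] at this
    rw [this]
    congr 2
    rw [mul_pow, ht2]
    simp only [zero_mul, NNReal.coe_one, zero_add, one_mul]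
    field_simp
    norm_num
  simp_rw [h1]
  rw [lintegral_lintegral_swap (by fun_prop)]
  refine le_trans (lintegral_mono fun g => ?_) lintegral_exp_sq_div_four_gaussianReal_le
  have h2 : ∀ ω, Real.exp (t * Z ω * g) = Real.exp (t * g * Z ω) := fun ω => by ring_nf
  simp_rw [h2]
  rw [← ofReal_integral_eq_lintegral_ofReal (hZ.integrable_exp_mul _)
    (Filter.Eventually.of_forall fun x => (Real.exp_pos _).le)]
  refine ENNReal.ofReal_le_ofReal ((hZ.mgf_le (t * g)).trans_eq ?_)
  rw [mul_pow, ht2]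
  congr 1
  field_simp
  ring

/-- The moment generating function of the square of a sub-Gaussian variable near zero. -/
lemma ProbabilityTheory.HasSubgaussianMGF.mgf_sq_le {Z : Ω → ℝ} {s : ℝ≥0}
    (hZ : HasSubgaussianMGF Z s μ) (hZm : Measurable Z) (hs : 0 < s) {l : ℝ}
    (hl : |l| ≤ 1 / (8 * s)) :
    Integrable (fun ω => Real.exp (l * Z ω ^ 2)) μ ∧
      mgf (fun ω => Z ω ^ 2) μ l
        ≤ Real.exp (l * (∫ ω, Z ω ^ 2 ∂μ) + 256 * l ^ 2 * (s : ℝ) ^ 2) := by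
  have hs' : (0 : ℝ) < s := hs
  have hl' : |l| * (8 * s) ≤ 1 := by rwa [le_div_iff₀ (by positivity)] at hl
  have hlin := hZ.lintegral_exp_sq_le hZm hs
  have hint : Integrable (fun ω => Real.exp (Z ω ^ 2 / (4 * s))) μ := by
    refine ⟨by fun_prop, ?_⟩
    rw [hasFiniteIntegral_iff_ofReal (Filter.Eventually.of_forall fun x => (Real.exp_pos _).le)]
    exact hlin.trans_lt (by simp)
  have hI : ∫ ω, Real.exp (Z ω ^ 2 / (4 * s)) ∂μ ≤ 2 := by
    rw [integral_eq_lintegral_of_nonneg_ae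
      (Filter.Eventually.of_forall fun x => (Real.exp_pos _).le) (by fun_prop)]
    exact ENNReal.toReal_le_of_le_ofReal (by norm_num) (by simpa using hlin)
  have hZ2 : Integrable (fun ω => Z ω ^ 2) μ := (hZ.memLp 2).integrable_sq
  have hpt : ∀ z : ℝ, Real.exp (l * z ^ 2)
      ≤ 1 + l * z ^ 2 + 128 * l ^ 2 * (s : ℝ) ^ 2 * Real.exp (z ^ 2 / (4 * s)) := fun z => by
    set y : ℝ := z ^ 2 / (8 * s) with hy
    have hy0 : 0 ≤ y := by positivity
    have hz : z ^ 2 = 8 * s * y := by rw [hy]; field_simp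
    have hz' : z ^ 2 / (4 * s) = y + y := by rw [hz]; field_simp; ring
    have h1 := Real.exp_le_one_add_add_sq_mul_exp_abs (l * z ^ 2)
    have h2 : |l * z ^ 2| ≤ y := by
      rw [abs_mul, abs_of_nonneg (sq_nonneg z), hz, ← mul_assoc]
      exact mul_le_of_le_one_left hy0 hl'
    have h3 : y ^ 2 ≤ 2 * Real.exp y := by
      have := Real.pow_div_factorial_le_exp y hy0 2
      simp at this
      linarith
    have h4 : Real.exp |l * z ^ 2| ≤ Real.exp y := Real.exp_le_exp.2 h2
    have h5 : (l * z ^ 2) ^ 2 * Real.exp |l * z ^ 2|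
        ≤ 128 * l ^ 2 * (s : ℝ) ^ 2 * Real.exp (z ^ 2 / (4 * s)) := by
      rw [hz', Real.exp_add]
      calc (l * z ^ 2) ^ 2 * Real.exp |l * z ^ 2|
          = 64 * l ^ 2 * (s : ℝ) ^ 2 * y ^ 2 * Real.exp |l * z ^ 2| := by rw [hz]; ring_nf
        _ ≤ 64 * l ^ 2 * (s : ℝ) ^ 2 * (2 * Real.exp y) * Real.exp y := by gcongr
        _ = _ := by ring
    linarith
  have hint2 : Integrable (fun ω => 1 + l * Z ω ^ 2
      + 128 * l ^ 2 * (s : ℝ) ^ 2 * Real.exp (Z ω ^ 2 / (4 * s))) μ :=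
    ((integrable_const _).add (hZ2.const_mul _)).add (hint.const_mul _)
  have hint3 : Integrable (fun ω => Real.exp (l * Z ω ^ 2)) μ := by
    refine hint2.mono' (by fun_prop) (Filter.Eventually.of_forall fun ω => ?_)
    rw [Real.norm_of_nonneg (Real.exp_pos _).le]
    exact hpt _
  refine ⟨hint3, ?_⟩
  calc mgf (fun ω => Z ω ^ 2) μ l
      ≤ ∫ ω, (1 + l * Z ω ^ 2 + 128 * l ^ 2 * (s : ℝ) ^ 2 * Real.exp (Z ω ^ 2 / (4 * s))) ∂μ :=
        integral_mono hint3 hint2 fun ω => hpt _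
    _ = 1 + l * (∫ ω, Z ω ^ 2 ∂μ)
          + 128 * l ^ 2 * (s : ℝ) ^ 2 * ∫ ω, Real.exp (Z ω ^ 2 / (4 * s)) ∂μ := by
        have hi : Integrable (fun ω => 1 + l * Z ω ^ 2) μ :=
          (integrable_const _).add (hZ2.const_mul _)
        rw [integral_add hi (hint.const_mul _),
          integral_add (integrable_const _) (hZ2.const_mul _), integral_const_mul,
          integral_const_mul]
        simp
    _ ≤ 1 + l * (∫ ω, Z ω ^ 2 ∂μ) + 128 * l ^ 2 * (s : ℝ) ^ 2 * 2 := by gcongr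
    _ ≤ _ := by
        have := Real.add_one_le_exp (l * (∫ ω, Z ω ^ 2 ∂μ) + 256 * l ^ 2 * (s : ℝ) ^ 2)
        linarith

/-- Bernstein's inequality for the mean square of independent sub-Gaussian variables with a common
second moment `v`, at deviation `t s / 4`. -/
lemma measureReal_sum_sq_deviation_le {N : ℕ} {Z : Fin N → Ω → ℝ} {s : ℝ≥0} {v : ℝ}
    (hZ : ∀ i, HasSubgaussianMGF (Z i) s μ) (hZm : ∀ i, Measurable (Z i)) (hs : 0 < s)
    (hind : iIndepFun Z μ) (hv : ∀ i, ∫ ω, Z i ω ^ 2 ∂μ = v) {t : ℝ} (ht : 0 < t) :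
    μ.real {ω | N * (v + t * s / 4) ≤ ∑ i, Z i ω ^ 2 ∨ ∑ i, Z i ω ^ 2 ≤ N * (v - t * s / 4)}
      ≤ 2 * Real.exp (-(1 / 16384 * N * min t (t ^ 2))) := by
  have hs' : (0 : ℝ) < s := hs
  have hind2 : iIndepFun (fun i ω => Z i ω ^ 2) μ :=
    hind.comp (fun _ x => x ^ 2) fun _ => by fun_prop
  have hm : ∀ i, Measurable fun ω => Z i ω ^ 2 := fun i => (hZm i).pow_const 2
  have hsum : (fun ω => ∑ i, Z i ω ^ 2) = ∑ i, fun ω => Z i ω ^ 2 := by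
    ext ω; simp
  have key : ∀ l : ℝ, |l| ≤ 1 / (8 * s) →
      Integrable (fun ω => Real.exp (l * ∑ i, Z i ω ^ 2)) μ ∧
      mgf (fun ω => ∑ i, Z i ω ^ 2) μ l ≤ Real.exp (N * (l * v + 256 * l ^ 2 * (s : ℝ) ^ 2)) := by
    intro l hl
    constructor
    · have := hind2.integrable_exp_mul_sum hm (s := Finset.univ) (t := l)
        fun i _ => ((hZ i).mgf_sq_le (hZm i) hs hl).1
      simpa using this
    · rw [hsum, hind2.mgf_sum hm]
      refine (Finset.prod_le_prod (fun _ _ => mgf_nonneg) fun i _ =>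
        ((hZ i).mgf_sq_le (hZm i) hs hl).2).trans_eq ?_
      simp only [hv, Finset.prod_const, Finset.card_univ, Fintype.card_fin]
      rw [← Real.exp_nat_mul]
  -- the minimizer of the Chernoff exponent, truncated so that the moment bound applies
  set w : ℝ := min t 1 with hw
  have hw0 : 0 < w := lt_min ht one_pos
  have hw1 : w ≤ 1 := min_le_right _ _
  have hwt : w ≤ t := min_le_left _ _
  have hmin : min t (t ^ 2) = w * t := by
    rcases le_total t 1 with h | h
    · rw [hw, min_eq_left h, min_eq_right (by nlinarith), sq]
    · rw [hw, min_eq_right h, min_eq_left (by nlinarith), one_mul]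
  set l : ℝ := w / (2048 * s) with hl
  have hl0 : 0 < l := by positivity
  have hls : l * s = w / 2048 := by rw [hl]; field_simp
  have habs : |l| ≤ 1 / (8 * s) := by
    rw [abs_of_pos hl0, hl, div_le_div_iff₀ (by positivity) (by positivity)]
    nlinarith
  have hexp : N * (256 * l ^ 2 * (s : ℝ) ^ 2) - N * (l * (t * s / 4))
      ≤ -(1 / 16384 * N * min t (t ^ 2)) := by
    have e1 : 256 * l ^ 2 * (s : ℝ) ^ 2 = 256 * (l * s) ^ 2 := by ring
    have e2 : l * (t * s / 4) = l * s * t / 4 := by ring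
    rw [e1, e2, hls, hmin]
    have hN : (0 : ℝ) ≤ N := Nat.cast_nonneg N
    have : w * w ≤ w * t := by gcongr
    nlinarith
  have hU := (measure_ge_le_exp_mul_mgf (μ := μ) (X := fun ω => ∑ i, Z i ω ^ 2)
    (N * (v + t * s / 4)) hl0.le (key l habs).1).trans
    (mul_le_mul_of_nonneg_left (key l habs).2 (Real.exp_pos _).le)
  have habs' : |-l| ≤ 1 / (8 * s) := by rwa [abs_neg]
  have hD := (measure_le_le_exp_mul_mgf (μ := μ) (X := fun ω => ∑ i, Z i ω ^ 2)
    (N * (v - t * s / 4)) (neg_nonpos.2 hl0.le) (key (-l) habs').1).trans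
    (mul_le_mul_of_nonneg_left (key (-l) habs').2 (Real.exp_pos _).le)
  rw [← Real.exp_add] at hU hD
  have hU' := hU.trans (Real.exp_le_exp.2 (le_trans (le_of_eq (by ring)) hexp))
  have hD' := hD.trans (Real.exp_le_exp.2 (le_trans (le_of_eq (by ring)) hexp))
  rw [Set.ofPred_or]
  refine (measureReal_union_le _ _).trans ?_
  linarith

end SubGaussianSquare

namespace TTReg

/-! ### The predictors -/

lemma IsSubGaussianVec.hasSubgaussianMGF_inner {Ω ι : Type*} [MeasurableSpace Ω] [Fintype ι]
    {μ : Measure Ω} {x : Ω → EuclideanSpace ℝ ι} (hx : Measurable x) {s : ℝ≥0}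
    (h : IsSubGaussianVec (μ.map x) s) (v : EuclideanSpace ℝ ι) :
    HasSubgaussianMGF (fun ω => inner ℝ v (x ω)) (s * ‖v‖₊ ^ 2) μ :=
  HasSubgaussianMGF.of_map hx.aemeasurable (h v)

lemma IsSubGaussianVec.memLp_apply {ι : Type*} [Fintype ι] [DecidableEq ι]
    {ν : Measure (EuclideanSpace ℝ ι)} {s : ℝ≥0} (h : IsSubGaussianVec ν s) (j : ι) :
    MemLp (fun x => x j) 2 ν := by
  have := (h (EuclideanSpace.single j 1)).memLp 2
  simpa [EuclideanSpace.inner_single_left] using this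

/-- The second moment of a one-dimensional marginal is a value of the quadratic form of the
covariance matrix. -/
lemma integral_inner_sq_eq {Ω ι : Type*} [MeasurableSpace Ω] [Fintype ι] [DecidableEq ι]
    {μ : Measure Ω} [IsProbabilityMeasure μ] {x : Ω → EuclideanSpace ℝ ι} (hx : Measurable x)
    {s : ℝ≥0} (h : IsSubGaussianVec (μ.map x) s) (h0 : ∫ ω, x ω ∂μ = 0)
    (v : EuclideanSpace ℝ ι) :
    ∫ ω, (inner ℝ v (x ω) : ℝ) ^ 2 ∂μ = v ⬝ᵥ (covMatrix (μ.map x)).mulVec v := by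
  have hp : IsProbabilityMeasure (μ.map x) := Measure.isProbabilityMeasure_map hx.aemeasurable
  have hLp : MemLp (fun y : EuclideanSpace ℝ ι => (inner ℝ v y : ℝ)) 2 (μ.map x) := (h v).memLp 2
  have hint : Integrable x μ := by
    have : ∀ j, Integrable (fun ω => x ω j) μ := fun j =>
      ((h.memLp_apply j).comp_of_map hx.aemeasurable).integrable (by norm_num)
    exact Integrable.of_eval_piLp this
  have hmean : ∫ y, (inner ℝ v y : ℝ) ∂(μ.map x) = 0 := by
    rw [integral_map hx.aemeasurable (by fun_prop), integral_inner hint, h0, inner_zero_right]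
  have hvar := variance_eq_sub hLp
  rw [hmean, zero_pow two_ne_zero, sub_zero] at hvar
  have hsq : ∫ ω, (inner ℝ v (x ω) : ℝ) ^ 2 ∂μ
      = ∫ y, ((fun y : EuclideanSpace ℝ ι => (inner ℝ v y : ℝ)) ^ 2) y ∂(μ.map x) := by
    rw [integral_map hx.aemeasurable (by fun_prop)]
    rfl
  rw [hsq, ← hvar, ← covariance_self (by fun_prop)]
  have hexp : (fun y : EuclideanSpace ℝ ι => (inner ℝ v y : ℝ)) = fun y => ∑ j, v j * y j := by
    funext y
    simp [PiLp.inner_apply, mul_comm]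
  rw [hexp, covariance_fun_sum_fun_sum (fun j => (h.memLp_apply j).const_mul _)
    fun j => (h.memLp_apply j).const_mul _]
  simp only [covariance_const_mul_left, covariance_const_mul_right, dotProduct, Matrix.mulVec,
    covMatrix, Matrix.of_apply, Finset.mul_sum]
  refine Finset.sum_congr rfl fun j _ => Finset.sum_congr rfl fun k _ => by ring

section Design

variable {n m : ℕ} {q : Fin n → ℕ} {p : Fin m → ℕ} {N : ℕ} {Ω : Type*} [MeasurableSpace Ω]
  {μ : Measure Ω} [IsProbabilityMeasure μ] {X : Fin N → Ω → Tensor p} {σ : ℝ≥0} {cx Cx : ℝ}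

lemma PredictorAssumption.second_moment_mem (hX : PredictorAssumption μ X σ cx Cx) (i : Fin N)
    {v : Tensor p} (hv : ‖v‖ = 1) :
    cx ≤ ∫ ω, (inner ℝ v (X i ω) : ℝ) ^ 2 ∂μ ∧ ∫ ω, (inner ℝ v (X i ω) : ℝ) ^ 2 ∂μ ≤ Cx := by
  rw [integral_inner_sq_eq (hX.measurable i) (hX.subGaussian i) (hX.mean_zero i)]
  have hvv : (v : _ → ℝ) ⬝ᵥ v = 1 := by
    have := EuclideanSpace.real_norm_sq_eq v
    rw [hv] at this
    simp only [dotProduct]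
    rw [← one_pow 2, this]
    exact Finset.sum_congr rfl fun _ _ => (sq _).symm
  have h1 := (hX.cov_lower i).dotProduct_mulVec_nonneg v
  have h2 := (hX.cov_upper i).dotProduct_mulVec_nonneg v
  simp only [star_trivial, Matrix.sub_mulVec, Matrix.smul_mulVec, Matrix.one_mulVec,
    dotProduct_sub, dotProduct_smul, hvv, smul_eq_mul, mul_one] at h1 h2
  constructor <;> linarith

/-- The empirical second moment of the predictors in one direction is comparable to the
eigenvalues of the covariance matrix, outside an event of exponentially small probability. -/
lemma PredictorAssumption.measureReal_deviation_le (hX : PredictorAssumption μ X σ cx Cx)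
    (hcx : 0 < cx) (hcC : cx ≤ Cx) (hσ : 0 < σ) (hind : iIndepFun X μ) {v : Tensor p}
    (hv : ‖v‖ = 1) :
    μ.real {ω | ¬ (N * (3 / 4 * cx) ≤ ∑ i, (inner ℝ v (X i ω) : ℝ) ^ 2 ∧
        ∑ i, (inner ℝ v (X i ω) : ℝ) ^ 2 ≤ N * (5 / 4 * Cx))}
      ≤ 2 * Real.exp (-(1 / 16384 * N * min (cx / (σ : ℝ) ^ 2) (cx ^ 2 / (σ : ℝ) ^ 4))) := by
  rcases isEmpty_or_nonempty (Fin N) with hN | ⟨⟨i₀⟩⟩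
  · obtain rfl : N = 0 := by
      by_contra h
      exact hN.false ⟨0, Nat.pos_of_ne_zero h⟩
    simp
  have hσ' : (0 : ℝ) < σ := hσ
  set w := ∫ ω, (inner ℝ v (X i₀ ω) : ℝ) ^ 2 ∂μ with hw
  have hsub : ∀ i, HasSubgaussianMGF (fun ω => (inner ℝ v (X i ω) : ℝ)) (σ ^ 2) μ := fun i => by
    have := (hX.subGaussian i).hasSubgaussianMGF_inner (hX.measurable i) v
    have hv' : ‖v‖₊ = 1 := NNReal.eq hv
    simpa [hv'] using this
  have hmeas : ∀ i, Measurable fun ω => (inner ℝ v (X i ω) : ℝ) := fun i => by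
    have := hX.measurable i
    fun_prop
  have hbern := measureReal_sum_sq_deviation_le (μ := μ) (v := w) hsub hmeas (by positivity)
    (hind.comp (fun _ x => (inner ℝ v x : ℝ)) fun _ => by fun_prop)
    (fun i => by
      have := ((hX.identDistrib i i₀).comp (u := fun x => (inner ℝ v x : ℝ) ^ 2)
        (by fun_prop)).integral_eq
      simpa using this)
    (t := cx / (σ : ℝ) ^ 2) (by positivity)
  rw [div_pow, ← pow_mul] at hbern
  obtain ⟨hlo, hhi⟩ := hX.second_moment_mem i₀ hv
  refine le_trans (measureReal_mono ?_) hbern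
  intro ω hω
  have hcancel : cx / (σ : ℝ) ^ 2 * ((σ ^ 2 : ℝ≥0) : ℝ) = cx := by
    push_cast
    field_simp
  simp only [Set.mem_ofPred_eq, hcancel] at hω ⊢
  by_contra! hcon
  refine hω ⟨?_, ?_⟩
  · refine le_trans ?_ hcon.2.le
    gcongr
    linarith
  · refine hcon.1.le.trans ?_
    gcongr
    linarith

/-- The rows of a coefficient tensor, one for each entry of the response. -/
noncomputable def coefRow (A : Coef q p) (j : ∀ a, Fin (q a)) : Tensor p :=
  WithLp.toLp 2 fun l => A (joinIdx j l)

lemma contract_apply (A : Coef q p) (x : Tensor p) (j : ∀ a, Fin (q a)) :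
    contract A x j = inner ℝ (coefRow A j) x := by
  simp [contract, coefRow, PiLp.inner_apply, mul_comm]

lemma sum_norm_coefRow_sq (A : Coef q p) : ∑ j, ‖coefRow A j‖ ^ 2 = ‖A‖ ^ 2 := by
  simp only [EuclideanSpace.norm_sq_eq, coefRow]
  rw [← Fintype.sum_prod_type']
  refine Fintype.sum_equiv (Equiv.sumPiEquivProdPi fun k => Fin (Sum.elim q p k)).symm _ _ ?_
  rintro ⟨j, l⟩
  have h : joinIdx j l = (Equiv.sumPiEquivProdPi fun k => Fin (Sum.elim q p k)).symm (j, l) := by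
    funext k
    rcases k with a | b <;> rfl
  exact congrArg (fun u => ‖A u‖ ^ 2) h

lemma norm_designMap_sq (x : Fin N → Tensor p) (A : Coef q p) :
    ‖designMap x A‖ ^ 2 = ∑ j, ∑ i, (inner ℝ (coefRow A j) (x i) : ℝ) ^ 2 := by
  rw [PiLp.norm_sq_eq_of_L2, Finset.sum_comm]
  refine Finset.sum_congr rfl fun i _ => ?_
  rw [designMap_apply, EuclideanSpace.norm_sq_eq]
  simp [contract_apply]

/-- For a fixed coefficient tensor the design map is well conditioned with high probability, by a
union bound over the entries of the response. -/
lemma PredictorAssumption.exists_design_event (hX : PredictorAssumption μ X σ cx Cx)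
    (hcx : 0 < cx) (hcC : cx ≤ Cx) (hσ : 0 < σ) (hind : iIndepFun X μ) (A : Coef q p) :
    ∃ B : Set Ω, MeasurableSet B ∧
      μ.real B ≤ (∏ a, (q a : ℝ)) * (2 * Real.exp
        (-(1 / 16384 * N * min (cx / (σ : ℝ) ^ 2) (cx ^ 2 / (σ : ℝ) ^ 4)))) ∧
      ∀ ω ∉ B, N * (3 / 4 * cx) * ‖A‖ ^ 2 ≤ ‖designMap (fun i => X i ω) A‖ ^ 2 ∧
        ‖designMap (fun i => X i ω) A‖ ^ 2 ≤ N * (5 / 4 * Cx) * ‖A‖ ^ 2 := by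
  classical
  have hXm := hX.measurable
  have hrow : ∀ j : ∀ a, Fin (q a), ∃ B : Set Ω, MeasurableSet B ∧ μ.real B ≤ 2 * Real.exp
        (-(1 / 16384 * N * min (cx / (σ : ℝ) ^ 2) (cx ^ 2 / (σ : ℝ) ^ 4))) ∧
      ∀ ω ∉ B,
        N * (3 / 4 * cx) * ‖coefRow A j‖ ^ 2 ≤ ∑ i, (inner ℝ (coefRow A j) (X i ω) : ℝ) ^ 2 ∧
        ∑ i, (inner ℝ (coefRow A j) (X i ω) : ℝ) ^ 2 ≤ N * (5 / 4 * Cx) * ‖coefRow A j‖ ^ 2 := by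
    intro j
    by_cases h0 : coefRow A j = 0
    · exact ⟨∅, .empty, by simp; positivity, fun ω _ => by simp [h0]⟩
    set v : Tensor p := ‖coefRow A j‖⁻¹ • coefRow A j with hv
    have hvn : ‖v‖ = 1 := norm_smul_inv_norm h0
    have hrv : coefRow A j = ‖coefRow A j‖ • v := by
      rw [hv, smul_smul, mul_inv_cancel₀ (norm_ne_zero_iff.2 h0), one_smul]
    refine ⟨{ω | ¬ (N * (3 / 4 * cx) ≤ ∑ i, (inner ℝ v (X i ω) : ℝ) ^ 2 ∧
        ∑ i, (inner ℝ v (X i ω) : ℝ) ^ 2 ≤ N * (5 / 4 * Cx))}, ?_,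
      hX.measureReal_deviation_le hcx hcC hσ hind hvn, fun ω hω => ?_⟩
    · have hsm : Measurable fun ω => ∑ i, (inner ℝ v (X i ω) : ℝ) ^ 2 := by fun_prop
      exact ((measurableSet_le measurable_const hsm).inter
        (measurableSet_le hsm measurable_const)).compl
    · simp only [Set.mem_ofPred_eq, not_not] at hω
      have hs : ∑ i, (inner ℝ (coefRow A j) (X i ω) : ℝ) ^ 2
          = ‖coefRow A j‖ ^ 2 * ∑ i, (inner ℝ v (X i ω) : ℝ) ^ 2 := by
        rw [Finset.mul_sum]
        refine Finset.sum_congr rfl fun i _ => ?_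
        conv_lhs => rw [hrv, real_inner_smul_left, mul_pow]
      rw [hs, mul_comm _ (‖coefRow A j‖ ^ 2), mul_comm _ (‖coefRow A j‖ ^ 2)]
      exact ⟨by gcongr; exact hω.1, by gcongr; exact hω.2⟩
  choose B hBm hBp hB using hrow
  refine ⟨⋃ j, B j, .iUnion hBm, ?_, fun ω hω => ?_⟩
  · refine (measureReal_iUnion_fintype_le _).trans ((Finset.sum_le_sum fun j _ => hBp j).trans_eq ?_)
    rw [Finset.sum_const, nsmul_eq_mul, Finset.card_univ, Fintype.card_pi]
    simp
  · simp only [Set.mem_iUnion, not_exists] at hω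
    rw [norm_designMap_sq, ← sum_norm_coefRow_sq, Finset.mul_sum, Finset.mul_sum]
    exact ⟨Finset.sum_le_sum fun j _ => (hB j ω (hω j)).1,
      Finset.sum_le_sum fun j _ => (hB j ω (hω j)).2⟩

end Design

/-! ### The noise -/

section Noise

variable {Ω α ι : Type*} [MeasurableSpace Ω] [MeasurableSpace α] [Fintype ι] {μ : Measure Ω}
  [IsProbabilityMeasure μ]

/-- If `E` is sub-Gaussian conditionally on `X`, then the exponential of `l ⟨g(X), E⟩`, compensated
by the conditional variance proxy, has expectation at most one. -/
lemma integrable_and_mgf_compensated_le {X : Ω → α} {E : Ω → EuclideanSpace ℝ ι} {κ : ℝ≥0}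
    (hX : Measurable X) (hE : Measurable E)
    (h : ∀ᵐ x ∂(μ.map X), IsSubGaussianVec (condDistrib E X μ x) (κ ^ 2))
    {g : α → EuclideanSpace ℝ ι} (hg : Measurable g) (l : ℝ) :
    Integrable (fun ω => Real.exp (l * inner ℝ (g (X ω)) (E ω)
        - l ^ 2 * (κ : ℝ) ^ 2 / 2 * ‖g (X ω)‖ ^ 2)) μ ∧
      ∫ ω, Real.exp (l * inner ℝ (g (X ω)) (E ω)
        - l ^ 2 * (κ : ℝ) ^ 2 / 2 * ‖g (X ω)‖ ^ 2) ∂μ ≤ 1 := by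
  obtain ⟨f, hfz⟩ : ∃ f : α × EuclideanSpace ℝ ι → ℝ, ∀ z, f z =
      Real.exp (l * inner ℝ (g z.1) z.2 - l ^ 2 * (κ : ℝ) ^ 2 / 2 * ‖g z.1‖ ^ 2) :=
    ⟨_, fun _ => rfl⟩
  have hf : Measurable f := by
    rw [funext hfz]
    fun_prop
  have hfpos : ∀ z, 0 ≤ f z := fun z => by rw [hfz]; positivity
  have hfm : Measurable fun ω => f (X ω, E ω) := hf.comp (hX.prodMk hE)
  have hlin : ∫⁻ ω, ENNReal.ofReal (f (X ω, E ω)) ∂μ ≤ 1 := by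
    calc ∫⁻ ω, ENNReal.ofReal (f (X ω, E ω)) ∂μ
        = ∫⁻ z, ENNReal.ofReal (f z) ∂(μ.map fun ω => (X ω, E ω)) := by
          rw [lintegral_map (by fun_prop) (by fun_prop)]
      _ = ∫⁻ x, ∫⁻ e, ENNReal.ofReal (f (x, e)) ∂(condDistrib E X μ x) ∂(μ.map X) := by
          rw [← compProd_map_condDistrib hE.aemeasurable, Measure.lintegral_compProd (by fun_prop)]
      _ ≤ ∫⁻ _, 1 ∂(μ.map X) := by
          refine lintegral_mono_ae ?_
          filter_upwards [h] with x hx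
          have hsub := hx (g x)
          have hmgf := hsub.mgf_le l
          have hfx : ∀ e, ENNReal.ofReal (f (x, e))
              = ENNReal.ofReal (Real.exp (-(l ^ 2 * (κ : ℝ) ^ 2 / 2 * ‖g x‖ ^ 2)))
                * ENNReal.ofReal (Real.exp (l * inner ℝ (g x) e)) := fun e => by
            rw [← ENNReal.ofReal_mul (Real.exp_pos _).le, ← Real.exp_add, hfz]
            congr 2
            ring
          simp_rw [hfx]
          rw [lintegral_const_mul _ (by fun_prop),
            ← ofReal_integral_eq_lintegral_ofReal (hsub.integrable_exp_mul l)
              (Filter.Eventually.of_forall fun x => (Real.exp_pos _).le),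
            ← ENNReal.ofReal_mul (Real.exp_pos _).le]
          refine ENNReal.ofReal_le_one.2 ?_
          refine (mul_le_mul_of_nonneg_left hmgf (Real.exp_pos _).le).trans_eq ?_
          rw [← Real.exp_add]
          push_cast
          rw [← Real.exp_zero]
          congr 1
          ring
      _ = 1 := by
          have := Measure.isProbabilityMeasure_map (μ := μ) hX.aemeasurable
          simp
  have hint : Integrable (fun ω => f (X ω, E ω)) μ := by
    refine ⟨hfm.aestronglyMeasurable, ?_⟩
    rw [hasFiniteIntegral_iff_ofReal (Filter.Eventually.of_forall fun ω => hfpos _)]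
    exact hlin.trans_lt (by simp)
  have hle : ∫ ω, f (X ω, E ω) ∂μ ≤ 1 := by
    rw [integral_eq_lintegral_of_nonneg_ae (Filter.Eventually.of_forall fun ω => hfpos _)
      hfm.aestronglyMeasurable]
    exact ENNReal.toReal_le_of_le_ofReal (by norm_num) (by simpa using hlin)
  simp only [hfz] at hint hle
  exact ⟨hint, hle⟩

variable {N : ℕ} {X : Fin N → Ω → α} {E : Fin N → Ω → EuclideanSpace ℝ ι} {κ : ℝ≥0}

lemma measureReal_noise_ge_le (hX : ∀ i, Measurable (X i)) (hE : ∀ i, Measurable (E i))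
    (h : ∀ i, ∀ᵐ x ∂(μ.map (X i)), IsSubGaussianVec (condDistrib (E i) (X i) μ x) (κ ^ 2))
    (hind : iIndepFun (fun i ω => (X i ω, E i ω)) μ)
    {g : α → EuclideanSpace ℝ ι} (hg : Measurable g) {l : ℝ} (hl : 0 ≤ l) (t V : ℝ) :
    μ.real {ω | t ≤ ∑ i, (inner ℝ (g (X i ω)) (E i ω) : ℝ) ∧ ∑ i, ‖g (X i ω)‖ ^ 2 ≤ V}
      ≤ Real.exp (-(l * t) + l ^ 2 * (κ : ℝ) ^ 2 / 2 * V) := by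
  let φ : α × EuclideanSpace ℝ ι → ℝ := fun z =>
    l * inner ℝ (g z.1) z.2 - l ^ 2 * (κ : ℝ) ^ 2 / 2 * ‖g z.1‖ ^ 2
  have hφ : Measurable φ := by fun_prop
  have hind2 : iIndepFun (fun i ω => φ (X i ω, E i ω)) μ := hind.comp (fun _ => φ) fun _ => hφ
  have hm : ∀ i, Measurable fun ω => φ (X i ω, E i ω) := fun i => by
    have := hX i
    have := hE i
    fun_prop
  have hone := fun i => integrable_and_mgf_compensated_le (hX i) (hE i) (h i) hg l
  have hint := hind2.integrable_exp_mul_sum hm (s := Finset.univ) (t := 1) fun i _ => by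
    simpa only [one_mul] using (hone i).1
  have hmgf : mgf (∑ i, fun ω => φ (X i ω, E i ω)) μ 1 ≤ 1 := by
    rw [hind2.mgf_sum hm]
    refine Finset.prod_le_one (fun _ _ => mgf_nonneg) fun i _ => ?_
    simpa only [mgf, one_mul] using (hone i).2
  have hch := measure_ge_le_exp_mul_mgf (μ := μ) (l * t - l ^ 2 * (κ : ℝ) ^ 2 / 2 * V)
    zero_le_one hint
  refine (measureReal_mono ?_).trans (hch.trans ?_)
  · rintro ω ⟨h1, h2⟩
    simp only [Set.mem_ofPred_eq, Finset.sum_apply, φ, Finset.sum_sub_distrib, ← Finset.mul_sum]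
    gcongr
  · refine (mul_le_of_le_one_right (Real.exp_pos _).le hmgf).trans_eq ?_
    congr 1
    ring

/-- Sub-Gaussian tail of the noise on the event that its conditional variance proxy is at most
`κ² V`. For `κ = 0` it says that the noise is almost surely nonpositive there. -/
lemma measureReal_noise_gt_le (hX : ∀ i, Measurable (X i)) (hE : ∀ i, Measurable (E i))
    (h : ∀ i, ∀ᵐ x ∂(μ.map (X i)), IsSubGaussianVec (condDistrib (E i) (X i) μ x) (κ ^ 2))
    (hind : iIndepFun (fun i ω => (X i ω, E i ω)) μ)
    {g : α → EuclideanSpace ℝ ι} (hg : Measurable g) {V a : ℝ} (hV : 0 < V) (ha : 0 ≤ a) :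
    μ.real {ω | κ * √(2 * a * V) < ∑ i, (inner ℝ (g (X i ω)) (E i ω) : ℝ) ∧
        ∑ i, ‖g (X i ω)‖ ^ 2 ≤ V} ≤ Real.exp (-a) := by
  rcases eq_or_ne κ 0 with rfl | hκ
  · have hnull : ∀ k : ℕ, μ {ω | 1 / ((k : ℝ) + 1) ≤ ∑ i, (inner ℝ (g (X i ω)) (E i ω) : ℝ) ∧
        ∑ i, ‖g (X i ω)‖ ^ 2 ≤ V} = 0 := fun k => by
      rw [← measureReal_eq_zero_iff]
      refine le_antisymm ?_ measureReal_nonneg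
      have hlim : Filter.Tendsto (fun l : ℝ => Real.exp (-(l * (1 / ((k : ℝ) + 1)))))
          Filter.atTop (nhds 0) := by
        refine Real.tendsto_exp_neg_atTop_nhds_zero.comp ?_
        exact Filter.tendsto_id.atTop_mul_const (by positivity)
      refine ge_of_tendsto hlim ?_
      filter_upwards [Filter.eventually_ge_atTop 0] with l hl
      simpa using measureReal_noise_ge_le hX hE h hind hg hl (1 / ((k : ℝ) + 1)) V
    have hsub : {ω | ((0 : ℝ≥0) : ℝ) * √(2 * a * V) < ∑ i, (inner ℝ (g (X i ω)) (E i ω) : ℝ) ∧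
        ∑ i, ‖g (X i ω)‖ ^ 2 ≤ V} ⊆ ⋃ k : ℕ, {ω | 1 / ((k : ℝ) + 1) ≤
          ∑ i, (inner ℝ (g (X i ω)) (E i ω) : ℝ) ∧ ∑ i, ‖g (X i ω)‖ ^ 2 ≤ V} := by
      rintro ω ⟨h1, h2⟩
      simp only [NNReal.coe_zero, zero_mul] at h1
      obtain ⟨k, hk⟩ := exists_nat_one_div_lt h1
      exact Set.mem_iUnion.2 ⟨k, hk.le, h2⟩
    have := measure_mono_null hsub (measure_iUnion_null hnull)
    rw [measureReal_def, this]
    simpa using (Real.exp_pos _).le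
  · have hκ' : (0 : ℝ) < κ := by positivity
    set b : ℝ := √(2 * a * V) with hb
    have hb2 : b ^ 2 = 2 * a * V := Real.sq_sqrt (by positivity)
    refine (measureReal_mono (Set.ofPred_subset_ofPred.2 fun ω hω => ⟨hω.1.le, hω.2⟩)).trans
      ((measureReal_noise_ge_le hX hE h hind hg (l := b / (κ * V)) (by positivity)
        (κ * b) V).trans_eq ?_)
    congr 1
    field_simp
    rw [hb2]
    ring

end Noise

end TTReg

namespace TTReg

variable {n m : ℕ} {q : Fin n → ℕ} {p : Fin m → ℕ} {N : ℕ}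

/-! ### Uniform control of the design and of the noise -/

lemma dLR_nonneg (q : Fin n → ℕ) (p : Fin m → ℕ) (r : Fin (n + m - 1) → ℕ) : 0 ≤ dLR q p r := by
  unfold dLR
  positivity

section Uniform

variable {Ω : Type*} [MeasurableSpace Ω] {μ : Measure Ω} [IsProbabilityMeasure μ]
  {X : Fin N → Ω → Tensor p} {E : Fin N → Ω → Tensor q} {σ κ : ℝ≥0} {cx Cx : ℝ}
  {r : Fin (n + m - 1) → ℕ} {e : EuclideanSpace ℝ (Fin (2 * rMax r))}

/-- The design map is well conditioned on all trains of contractive cores at once, outside an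
event of small probability. -/
lemma exists_uniform_design_event (hn : 1 ≤ n) (hX : PredictorAssumption μ X σ cx Cx)
    (hcx : 0 < cx) (hcC : cx < Cx) (hσ : 0 < σ) (hind : iIndepFun X μ) (he : ‖e‖ = 1) :
    ∃ B : Set Ω, MeasurableSet B ∧
      μ.real B ≤ 2 * (∏ a, (q a : ℝ)) *
        Real.exp (-(1 / 16384 * N * min (cx / (σ : ℝ) ^ 2) (cx ^ 2 / (σ : ℝ) ^ 4))
          + (0.5 * ((m : ℝ) + n) + 2) *
            Real.log (6 * √(Cx / cx) * ((m : ℝ) + n + 1)) * dLR q p r) ∧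
      ∀ ω ∉ B, ∀ G : ∀ k, Core (2 * rMax r) (modeDim q p k), (∀ k, ‖G k‖ ≤ 1) →
        ‖designMap (fun i => X i ω) (coefMap q p e G)‖ ^ 2 ≤ 144 / 25 * (Cx * N) ∧
        (‖coefMap q p e G‖ = 1 →
          cx * N / 4 ≤ ‖designMap (fun i => X i ω) (coefMap q p e G)‖ ^ 2) := by
  have hCx : 0 < Cx := hcx.trans hcC
  set D : ℝ := (n : ℝ) + m with hD
  have hD1 : 1 ≤ D := by
    have : (1 : ℝ) ≤ n := by exact_mod_cast hn
    have : (0 : ℝ) ≤ m := Nat.cast_nonneg m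
    linarith
  set ρ : ℝ := √(Cx / cx) with hρ
  have hρ1 : 1 ≤ ρ := Real.one_le_sqrt.2 ((one_le_div hcx).2 hcC.le)
  have hρ2 : ρ ^ 2 * cx = Cx := by
    rw [hρ, Real.sq_sqrt (by positivity)]
    field_simp
  -- at this resolution the error `D ε ‖Φ‖ ~ ‖Φ‖ / ρ` is small compared with `√(cx N)`
  set ε : ℝ := 1 / (16 * D * ρ) with hε
  have hε0 : 0 < ε := by positivity
  have hDρ : 1 ≤ D * ρ := one_le_mul_of_one_le_of_one_le hD1 hρ1
  have hDε : D * ε = 1 / (16 * ρ) := by rw [hε]; field_simp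
  have hε1 : ε ≤ 1 := by
    rw [hε, div_le_one (by positivity)]
    linarith
  obtain ⟨S, hS, hnet, hcard⟩ := exists_core_nets q p r hε0 hε1
  choose B hBm hBp hB using fun A : Coef q p =>
    hX.exists_design_event hcx hcC.le hσ hind A
  refine ⟨⋃ G ∈ Fintype.piFinset S, B (coefMap q p e G),
    Finset.measurableSet_biUnion _ fun G _ => hBm _, ?_, ?_⟩
  · have hent : Real.log (3 / ε) * dLR q p r ≤ (0.5 * ((m : ℝ) + n) + 2) *
        Real.log (6 * ρ * ((m : ℝ) + n + 1)) * dLR q p r := by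
      refine mul_le_mul_of_nonneg_right ?_ (dLR_nonneg q p r)
      have hDm : (m : ℝ) + n = D := add_comm _ _
      rw [hDm]
      have h1 : 3 / ε ≤ (6 * ρ * (D + 1)) ^ 2 := by
        have : 3 / ε = 48 * (D * ρ) := by rw [hε]; field_simp; norm_num
        rw [this]
        have h2 : (6 * ρ * (D + 1)) ^ 2 = 36 * (ρ * D) ^ 2 + 72 * ρ * (D * ρ) + 36 * ρ ^ 2 := by
          ring
        rw [h2]
        nlinarith
      have h3 : 0 ≤ Real.log (6 * ρ * (D + 1)) := Real.log_nonneg (by nlinarith)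
      calc Real.log (3 / ε) ≤ Real.log ((6 * ρ * (D + 1)) ^ 2) :=
            Real.log_le_log (by positivity) h1
        _ = 2 * Real.log (6 * ρ * (D + 1)) := by rw [Real.log_pow]; norm_num
        _ ≤ _ := by
          gcongr
          linarith
    refine (measureReal_biUnion_finset_le _ _).trans
      ((Finset.sum_le_sum fun G _ => hBp _).trans ?_)
    rw [Finset.sum_const, nsmul_eq_mul]
    refine (mul_le_mul_of_nonneg_right (hcard.trans (Real.exp_le_exp.2 hent))
      (by positivity)).trans_eq ?_
    rw [Real.exp_add]
    ring
  · intro ω hω G hG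
    simp only [Set.mem_iUnion, not_exists] at hω
    set y : ℝ := √(cx * N) with hy
    have hy2 : y ^ 2 = cx * N := Real.sq_sqrt (by positivity)
    have hy0 : 0 ≤ y := Real.sqrt_nonneg _
    have hCN : Cx * N = (ρ * y) ^ 2 := by rw [mul_pow, hy2, ← hρ2]; ring
    -- `4 / 5` and `6 / 5` are convenient bounds for `√(3 / 4)` and `√(5 / 4)`
    obtain ⟨h1, h2⟩ := norm_linearMap_coefMap_bounds hn (designMap fun i => X i ω) he hε0
      (lo := 4 / 5 * y) (hi := 6 / 5 * (ρ * y))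
      (by
        rw [hDε, div_le_div_iff₀ (by positivity) (by positivity)]
        linarith)
      (by positivity) (by positivity) S hS hnet
      (fun G hG => by
        refine (sq_le_sq₀ (by positivity) (by positivity)).1 (le_trans ?_ (hB _ ω (hω G hG)).1)
        have : (4 / 5 * y * ‖coefMap q p e G‖) ^ 2 = 16 / 25 * y ^ 2 * ‖coefMap q p e G‖ ^ 2 := by
          ring
        rw [this, hy2]
        refine mul_le_mul_of_nonneg_right ?_ (sq_nonneg _)
        nlinarith [mul_nonneg hcx.le (Nat.cast_nonneg (α := ℝ) N)])
      (fun G hG => by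
        refine (sq_le_sq₀ (by positivity) (by positivity)).1 ((hB _ ω (hω G hG)).2.trans ?_)
        have : (6 / 5 * (ρ * y) * ‖coefMap q p e G‖) ^ 2
            = 36 / 25 * (ρ * y) ^ 2 * ‖coefMap q p e G‖ ^ 2 := by ring
        rw [this, ← hCN]
        refine mul_le_mul_of_nonneg_right ?_ (sq_nonneg _)
        nlinarith [mul_nonneg hCx.le (Nat.cast_nonneg (α := ℝ) N)])
      G hG
    refine ⟨?_, fun hG1 => ?_⟩
    · refine (pow_le_pow_left₀ (norm_nonneg _) h1 2).trans_eq ?_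
      rw [hCN]
      ring
    · have h3 := h2 hG1
      rw [hDε] at h3
      have h4 : 1 / (16 * ρ) ≤ 1 / 16 :=
        one_div_le_one_div_of_le (by norm_num) (by linarith)
      have h5 : 1 / (16 * ρ) * (2 * (6 / 5 * (ρ * y))) = 3 / 20 * y := by
        field_simp
        ring
      have h6 : 1 / 2 * y ≤ ‖designMap (fun i => X i ω) (coefMap q p e G)‖ := by
        rw [h5] at h3
        nlinarith
      have h7 := pow_le_pow_left₀ (by positivity) h6 2
      rw [mul_pow, hy2] at h7
      linarith

lemma measurable_contract (A : Coef q p) : Measurable (contract A) := by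
  unfold contract
  fun_prop

/-- The noise is bounded on all trains of contractive cores at once, outside an event of small
probability, wherever the design map is bounded on them. -/
lemma exists_uniform_noise_event (hn : 1 ≤ n) (hXm : ∀ i, Measurable (X i))
    (hE : ErrorAssumption μ X E κ) (hind : iIndepFun (fun i ω => (X i ω, E i ω)) μ)
    {V δ : ℝ} (hV : 0 < V) (hδ : 1 < δ) :
    ∃ B : Set Ω, MeasurableSet B ∧
      μ.real B ≤ Real.exp (-(δ ^ 2 * (0.5 * ((m : ℝ) + n) + 2) *
        Real.log (6 * (m : ℝ) + 6 * n + 6) * dLR q p r)) ∧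
      ∀ ω ∉ B, (∀ G : ∀ k, Core (2 * rMax r) (modeDim q p k), (∀ k, ‖G k‖ ≤ 1) →
          ‖designMap (fun i => X i ω) (coefMap q p e G)‖ ^ 2 ≤ V) →
        ∀ G : ∀ k, Core (2 * rMax r) (modeDim q p k), (∀ k, ‖G k‖ ≤ 1) →
          inner ℝ (WithLp.toLp 2 fun i => E i ω : PiLp 2 fun _ : Fin N => Tensor q)
            (designMap (fun i => X i ω) (coefMap q p e G))
          ≤ 2 * (κ * √(2 * (2 * (δ ^ 2 * (0.5 * ((m : ℝ) + n) + 2) *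
            Real.log (6 * (m : ℝ) + 6 * n + 6) * dLR q p r)) * V)) := by
  have : Nonempty (Fin (n + m)) := ⟨⟨0, by omega⟩⟩
  set D : ℝ := (n : ℝ) + m with hD
  have hDm : (m : ℝ) + n = D := add_comm _ _
  have hDm' : 6 * (m : ℝ) + 6 * n + 6 = 6 * (D + 1) := by rw [hD]; ring
  rw [hDm, hDm']
  have hD1 : 1 ≤ D := by
    have : (1 : ℝ) ≤ n := by exact_mod_cast hn
    have : (0 : ℝ) ≤ m := Nat.cast_nonneg m
    linarith
  have hε0 : 0 < 1 / (2 * D) := by positivity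
  have hε1 : 1 / (2 * D) ≤ 1 := by
    rw [div_le_one (by positivity)]
    linarith
  have hlog : 0 ≤ Real.log (6 * (D + 1)) := Real.log_nonneg (by linarith)
  have hd := dLR_nonneg q p r
  set a : ℝ := δ ^ 2 * (0.5 * D + 2) * Real.log (6 * (D + 1)) * dLR q p r with ha
  have ha0 : 0 ≤ a := by positivity
  obtain ⟨S, hS, hnet, hcard⟩ := exists_core_nets q p r hε0 hε1
  have hEm := hE.measurable
  let B : Coef q p → Set Ω := fun A =>
    {ω | κ * √(2 * (2 * a) * V) < ∑ i, (inner ℝ (contract A (X i ω)) (E i ω) : ℝ) ∧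
      ∑ i, ‖contract A (X i ω)‖ ^ 2 ≤ V}
  have hBm : ∀ A, MeasurableSet (B A) := fun A => by
    have h1 : ∀ i, Measurable fun ω => contract A (X i ω) :=
      fun i => (measurable_contract A).comp (hXm i)
    have h2 : Measurable fun ω => ∑ i, (inner ℝ (contract A (X i ω)) (E i ω) : ℝ) := by fun_prop
    have h3 : Measurable fun ω => ∑ i, ‖contract A (X i ω)‖ ^ 2 := by fun_prop
    exact (measurableSet_lt measurable_const h2).inter (measurableSet_le h3 measurable_const)
  -- half of the exponent `2 a` pays for the union bound over the nets
  have hBp : ∀ A, μ.real (B A) ≤ Real.exp (-(2 * a)) := fun A =>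
    measureReal_noise_gt_le hXm hEm hE.cond_subGaussian hind (measurable_contract A) hV
      (by positivity)
  refine ⟨⋃ G ∈ Fintype.piFinset S, B (coefMap q p e G),
    Finset.measurableSet_biUnion _ fun G _ => hBm _, ?_, ?_⟩
  · have hent : Real.log (3 / (1 / (2 * D))) * dLR q p r ≤ a := by
      rw [ha]
      refine mul_le_mul_of_nonneg_right ?_ hd
      have h1 : Real.log (3 / (1 / (2 * D))) ≤ Real.log (6 * (D + 1)) := by
        refine Real.log_le_log (by positivity) ?_
        rw [div_div_eq_mul_div]
        linarith
      refine h1.trans (le_mul_of_one_le_left hlog ?_)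
      nlinarith
    refine (measureReal_biUnion_finset_le _ _).trans
      ((Finset.sum_le_sum fun G _ => hBp _).trans ?_)
    rw [Finset.sum_const, nsmul_eq_mul]
    refine (mul_le_mul_of_nonneg_right (hcard.trans (Real.exp_le_exp.2 hent))
      (by positivity)).trans_eq ?_
    rw [← Real.exp_add]
    congr 1
    ring
  · intro ω hω hbdd
    simp only [Set.mem_iUnion, not_exists] at hω
    set x : PiLp 2 fun _ : Fin N => Tensor q := WithLp.toLp 2 fun i => E i ω with hx
    refine (coefMap q p e).sublinear_le_of_net
      (fun A => inner ℝ x (designMap (fun i => X i ω) A)) (C := ‖x‖ * √V)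
      (fun A A' => by rw [map_add, inner_add_right])
      (fun c A _ => by rw [map_smul, inner_smul_right])
      hε0 (by rw [Fintype.card_fin]; push_cast; rw [← hD]; field_simp; exact le_rfl) ?_ S hS hnet ?_
    · intro G hG
      refine (real_inner_le_norm _ _).trans ?_
      gcongr
      exact Real.le_sqrt_of_sq_le (hbdd G hG)
    · intro G hG
      have h1 := hω G (Fintype.mem_piFinset.2 hG)
      have h2 : inner ℝ x (designMap (fun i => X i ω) (coefMap q p e G))
          = ∑ i, (inner ℝ (contract (coefMap q p e G) (X i ω)) (E i ω) : ℝ) := by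
        rw [PiLp.inner_apply]
        exact Finset.sum_congr rfl fun i _ => real_inner_comm _ _
      have h3 := hbdd G fun k => hS k _ (hG k)
      rw [PiLp.norm_sq_eq_of_L2] at h3
      by_contra! hcon
      exact h1 ⟨by rw [← h2]; exact hcon, h3⟩

end Uniform

end TTReg

namespace TTReg

variable {n m : ℕ} {q : Fin n → ℕ} {p : Fin m → ℕ} {N : ℕ}

/-! ### The error bound -/

lemma eq_zero_of_mem_ttSet_of_rMax_eq_zero (hn : 1 ≤ n) (hm : 1 ≤ m) {r : Fin (n + m - 1) → ℕ}
    (hr : rMax r = 0) {A : Coef q p} (hA : A ∈ ttSet q p r) : A = 0 := by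
  let k : Fin (n + m - 1) := ⟨0, by omega⟩
  have h1 : r k ≤ rMax r := Finset.le_sup (Finset.mem_univ k)
  have h2 : (seqMat A (k.val + 1)).rank = 0 := by
    have := hA k
    omega
  have h3 := (seqMat A (k.val + 1)).exists_factorization_of_rank_le h2.le
  obtain ⟨P, Q, hPQ⟩ := h3
  ext u
  rw [apply_eq_seqMat A (k.val + 1), hPQ]
  simp

/-- The error bound on the intersection of the design event and the noise event, when the
dimensions and the ranks are positive and there is at least one observation. -/
lemma exists_event_of_nondegenerate {Ω : Type*} [MeasurableSpace Ω] {μ : Measure Ω}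
    [IsProbabilityMeasure μ] {X : Fin N → Ω → Tensor p} {E Y : Fin N → Ω → Tensor q}
    {σ κ : ℝ≥0} {cx Cx : ℝ} {r : Fin (n + m - 1) → ℕ} {A₀ : Coef q p} (hn : 1 ≤ n)
    (hN : 0 < N) (hq : ∀ a, 0 < q a) (hp : ∀ b, 0 < p b) (hr : 0 < rMax r) (hcx : 0 < cx)
    (hcC : cx < Cx) (hX : PredictorAssumption μ X σ cx Cx) (hE : ErrorAssumption μ X E κ)
    (hind : iIndepFun (fun i ω => (X i ω, E i ω)) μ) (hA₀ : HasTTRanks A₀ r)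
    (hY : ∀ i ω, Y i ω = contract A₀ (X i ω) + E i ω) {δ : ℝ} (hδ : 1 < δ) :
    ∃ S : Set Ω, MeasurableSet S ∧
      1 - 2 * (∏ a, (q a : ℝ)) *
          Real.exp (-(1 / 16384 * N * min (cx / (σ : ℝ) ^ 2) (cx ^ 2 / (σ : ℝ) ^ 4))
            + (0.5 * ((m : ℝ) + n) + 2) *
              Real.log (6 * √(Cx / cx) * ((m : ℝ) + n + 1)) * dLR q p r)
        - Real.exp (-(δ ^ 2 * (0.5 * ((m : ℝ) + n) + 2) *
            Real.log (6 * (m : ℝ) + 6 * n + 6) * dLR q p r))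
        ≤ μ.real S ∧
      ∀ ω ∈ S,
        (∃ A, IsOLS r (fun i => Y i ω) (fun i => X i ω) A) ∧
        ∀ A, IsOLS r (fun i => Y i ω) (fun i => X i ω) A →
          ‖A - A₀‖ ≤ δ * 77 * κ / cx *
            √(Cx * (0.5 * ((m : ℝ) + n) + 2) * Real.log (6 * (m : ℝ) + 6 * n + 6) *
              dLR q p r / N) := by
  have hCx : 0 < Cx := hcx.trans hcC
  have hN' : (0 : ℝ) < N := by exact_mod_cast hN
  have hR : 0 < 2 * rMax r := by omega
  let e : EuclideanSpace ℝ (Fin (2 * rMax r)) := EuclideanSpace.single ⟨0, hR⟩ 1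
  have he : ‖e‖ = 1 := by simp [e]
  -- `σ = 0` would make the predictors vanish, against the lower bound on their covariance
  have hσ : 0 < σ := by
    refine pos_iff_ne_zero.2 fun hσ0 => ?_
    let v : Tensor p := EuclideanSpace.single (fun b => ⟨0, hp b⟩) 1
    have hv : ‖v‖ = 1 := by simp [v]
    have hsub := (hX.subGaussian ⟨0, hN⟩).hasSubgaussianMGF_inner (hX.measurable _) v
    rw [hσ0, zero_pow two_ne_zero, zero_mul] at hsub
    have h0 : ∫ ω, (inner ℝ v (X ⟨0, hN⟩ ω) : ℝ) ^ 2 ∂μ = 0 := by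
      refine integral_eq_zero_of_ae ?_
      filter_upwards [hsub.ae_eq_zero_of_hasSubgaussianMGF_zero] with ω hω
      simp only [Pi.zero_apply] at hω ⊢
      rw [hω, zero_pow two_ne_zero]
    have := (hX.second_moment_mem ⟨0, hN⟩ hv).1
    linarith
  have hindX : iIndepFun X μ := hind.comp (fun _ => Prod.fst) fun _ => measurable_fst
  obtain ⟨B₁, hB₁m, hB₁p, hB₁⟩ :=
    exists_uniform_design_event (q := q) hn hX hcx hcC hσ hindX he
  obtain ⟨B₂, hB₂m, hB₂p, hB₂⟩ :=
    exists_uniform_noise_event (e := e) hn hX.measurable hE hind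
      (V := 144 / 25 * (Cx * N)) (by positivity) hδ
  refine ⟨(B₁ ∪ B₂)ᶜ, (hB₁m.union hB₂m).compl, ?_, fun ω hω => ?_⟩
  · rw [probReal_compl_eq_one_sub (hB₁m.union hB₂m)]
    have := measureReal_union_le (μ := μ) B₁ B₂
    linarith
  · rw [Set.mem_compl_iff, Set.mem_union, not_or] at hω
    have hdes := hB₁ ω hω.1
    have hnoi := hB₂ ω hω.2 fun G hG => (hdes G hG).1
    set T : ℝ := (0.5 * ((m : ℝ) + n) + 2) * Real.log (6 * (m : ℝ) + 6 * n + 6) * dLR q p r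
      with hT
    have hT0 : 0 ≤ T := by
      have : 0 ≤ Real.log (6 * (m : ℝ) + 6 * n + 6) :=
        Real.log_nonneg (by linarith [Nat.cast_nonneg (α := ℝ) m, Nat.cast_nonneg (α := ℝ) n])
      have := dLR_nonneg q p r
      positivity
    have hδT : δ ^ 2 * (0.5 * ((m : ℝ) + n) + 2) * Real.log (6 * (m : ℝ) + 6 * n + 6) * dLR q p r
        = δ ^ 2 * T := by rw [hT]; ring
    have hCT : Cx * (0.5 * ((m : ℝ) + n) + 2) * Real.log (6 * (m : ℝ) + 6 * n + 6) * dLR q p r / N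
        = Cx * T / N := by rw [hT]; ring
    rw [hδT] at hnoi
    rw [hCT]
    have hsqrt : √(2 * (2 * (δ ^ 2 * T)) * (144 / 25 * (Cx * N)))
        = 24 / 5 * δ * N * √(Cx * T / N) := by
      have h : 2 * (2 * (δ ^ 2 * T)) * (144 / 25 * (Cx * N))
          = (24 / 5 * δ * N) ^ 2 * (Cx * T / N) := by
        field_simp
        ring
      rw [h, Real.sqrt_mul (sq_nonneg _), Real.sqrt_sq (by positivity)]
    rw [hsqrt] at hnoi
    have hmem : A₀ ∈ ttSet q p r := fun k => (hA₀ k).le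
    -- every difference from the true tensor is a multiple of a train of contractive cores
    have hcores : ∀ A ∈ ttSet q p r, A - A₀ ≠ 0 →
        ∃ G : ∀ k, Core (2 * rMax r) (modeDim q p k), (∀ k, ‖G k‖ ≤ 1) ∧
          ‖coefMap q p e G‖ = 1 ∧ A - A₀ = ‖A - A₀‖ • coefMap q p e G := by
      intro A hA h0
      have h1 : ‖‖A - A₀‖⁻¹ • (A - A₀)‖ = 1 := norm_smul_inv_norm h0
      obtain ⟨G, hG, hGA⟩ := exists_coefMap_eq_smul_sub hn hq hp he hA hmem h1.le
      refine ⟨G, hG, hGA ▸ h1, ?_⟩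
      rw [← hGA, smul_smul, mul_inv_cancel₀ (norm_ne_zero_iff.2 h0), one_smul]
    obtain ⟨hex, herr⟩ := leastSquares_exists_and_error_le (isClosed_ttSet q p r)
      (designMap fun i => X i ω)
      (WithLp.toLp 2 fun i => E i ω : PiLp 2 fun _ : Fin N => Tensor q) hmem
      (a := cx * N / 4) (s := 2 * (κ * (24 / 5 * δ * N * √(Cx * T / N)))) (by positivity)
      (by positivity)
      (fun A hA => by
        by_cases h0 : A - A₀ = 0
        · simp [h0]
        obtain ⟨G, hG, hG1, hGA⟩ := hcores A hA h0
        have h2 := (hdes G hG).2 hG1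
        have h3 : ‖designMap (fun i => X i ω) (A - A₀)‖ ^ 2
            = ‖designMap (fun i => X i ω) (coefMap q p e G)‖ ^ 2 * ‖A - A₀‖ ^ 2 := by
          conv_lhs => rw [hGA, map_smul, norm_smul, norm_norm, mul_pow, mul_comm]
        rw [h3]
        gcongr)
      (fun A hA => by
        by_cases h0 : A - A₀ = 0
        · simp [h0]
        obtain ⟨G, hG, -, hGA⟩ := hcores A hA h0
        have h2 := hnoi G hG
        conv_lhs => rw [hGA, map_smul, inner_smul_right, mul_comm]
        gcongr)
    have hrss : ∀ A, rss (fun i => Y i ω) (fun i => X i ω) A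
        = ‖(WithLp.toLp 2 fun i => E i ω : PiLp 2 fun _ : Fin N => Tensor q)
          - designMap (fun i => X i ω) (A - A₀)‖ ^ 2 := fun A =>
      rss_eq_norm_sq _ _ _ _ _ fun i => hY i ω
    constructor
    · obtain ⟨A, hA, hmin⟩ := hex
      exact ⟨A, hA, fun B hB => by rw [hrss, hrss]; exact hmin B hB⟩
    · intro A hA
      have h1 := hA.2 A₀ hmem
      rw [hrss, hrss] at h1
      refine (herr A hA.1 h1).trans ?_
      have h2 : 2 * (2 * (κ * (24 / 5 * δ * N * √(Cx * T / N)))) / (cx * N / 4)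
          = δ * (384 / 5) * κ / cx * √(Cx * T / N) := by
        field_simp
        ring
      rw [h2]
      gcongr
      norm_num

end TTReg

theorem theorem1 :
    ∃ c c₁ C₀ : ℝ, 0 < c ∧ 0 < c₁ ∧ 0 < C₀ ∧
      ∀ (n m : ℕ) (_ : 1 ≤ n) (_ : 1 ≤ m) (q : Fin n → ℕ) (p : Fin m → ℕ)
        (r : Fin (n + m - 1) → ℕ) (N : ℕ)
        (Ω : Type*) [MeasurableSpace Ω] (μ : Measure Ω) [IsProbabilityMeasure μ]
        (X : Fin N → Ω → Tensor p) (E Y : Fin N → Ω → Tensor q) (A₀ : Coef q p)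
        (σ κ : ℝ≥0) (cx Cx : ℝ),
        0 < cx → cx < Cx →
        PredictorAssumption μ X σ cx Cx →
        ErrorAssumption μ X E κ →
        iIndepFun (fun i ω => (X i ω, E i ω)) μ →
        HasTTRanks A₀ r →
        (∀ i ω, Y i ω = contract A₀ (X i ω) + E i ω) →
        C₀ * (max ((σ : ℝ) ^ 2 / cx) ((σ : ℝ) ^ 4 / cx ^ 2) *
          ((0.5 * ((m : ℝ) + n) + 2) * Real.log (6 * √(Cx / cx) * ((m : ℝ) + n + 1)) * dLR q p r
            + Real.log (∏ a, (q a : ℝ)))) ≤ N →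
        ∀ δ : ℝ, 1 < δ →
          ∃ S : Set Ω, MeasurableSet S ∧
            1 - 2 * (∏ a, (q a : ℝ)) *
                Real.exp (-(c * N * min (cx / (σ : ℝ) ^ 2) (cx ^ 2 / (σ : ℝ) ^ 4))
                  + (0.5 * ((m : ℝ) + n) + 2) *
                    Real.log (6 * √(Cx / cx) * ((m : ℝ) + n + 1)) * dLR q p r)
              - Real.exp (-(δ ^ 2 * (0.5 * ((m : ℝ) + n) + 2) *
                  Real.log (6 * (m : ℝ) + 6 * n + 6) * dLR q p r))
              ≤ μ.real S ∧
            ∀ ω ∈ S,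
              (∃ A, IsOLS r (fun i => Y i ω) (fun i => X i ω) A) ∧
              ∀ A, IsOLS r (fun i => Y i ω) (fun i => X i ω) A →
                ‖A - A₀‖ ≤ δ * c₁ * κ / cx *
                  √(Cx * (0.5 * ((m : ℝ) + n) + 2) * Real.log (6 * (m : ℝ) + 6 * n + 6) *
                    dLR q p r / N) := by
  refine ⟨1 / 16384, 77, 1, by norm_num, by norm_num, by norm_num, ?_⟩
  intro n m hn hm q p r N Ω _ μ _ X E Y A₀ σ κ cx Cx hcx hcC hX hE hind hA₀ hY _ δ hδ
  have hmem : A₀ ∈ ttSet q p r := fun k => (hA₀ k).le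
  by_cases hdeg : ∀ A ∈ ttSet q p r, A = A₀
  -- if the true tensor is the only admissible one, there is nothing to estimate
  · have hQ : (0 : ℝ) ≤ ∏ a, (q a : ℝ) := Finset.prod_nonneg fun _ _ => Nat.cast_nonneg _
    refine ⟨Set.univ, .univ, ?_, fun ω _ => ⟨⟨A₀, hmem, fun B hB => by rw [hdeg B hB]⟩,
      fun A hA => ?_⟩⟩
    · rw [probReal_univ]
      have h1 := Real.exp_pos (-(δ ^ 2 * (0.5 * ((m : ℝ) + n) + 2) *
        Real.log (6 * (m : ℝ) + 6 * n + 6) * dLR q p r))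
      have h2 := mul_nonneg (mul_nonneg zero_le_two hQ) (Real.exp_pos
        (-(1 / 16384 * N * min (cx / (σ : ℝ) ^ 2) (cx ^ 2 / (σ : ℝ) ^ 4))
          + (0.5 * ((m : ℝ) + n) + 2) *
            Real.log (6 * √(Cx / cx) * ((m : ℝ) + n + 1)) * dLR q p r)).le
      linarith
    · rw [hdeg A hA.1, sub_self, norm_zero]
      have : 0 < δ := one_pos.trans hδ
      positivity
  have hdim : (∀ a, 0 < q a) ∧ ∀ b, 0 < p b := by
    by_contra hcon
    refine hdeg fun A _ => ?_
    ext u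
    exfalso
    rw [not_and_or, not_forall, not_forall] at hcon
    rcases hcon with ⟨a, ha⟩ | ⟨b, hb⟩
    · exact ha ((Nat.zero_le _).trans_lt (u (Sum.inl a)).2)
    · exact hb ((Nat.zero_le _).trans_lt (u (Sum.inr b)).2)
  have hr : 0 < rMax r := by
    refine Nat.pos_of_ne_zero fun hr => hdeg fun A hA => ?_
    rw [eq_zero_of_mem_ttSet_of_rMax_eq_zero hn hm hr hA,
      eq_zero_of_mem_ttSet_of_rMax_eq_zero hn hm hr hmem]
  rcases Nat.eq_zero_or_pos N with rfl | hN
  -- without observations the lower bound on the probability is not positive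
  · refine ⟨∅, .empty, ?_, fun ω hω => absurd hω (Set.notMem_empty ω)⟩
    have hQ : (1 : ℝ) ≤ ∏ a, (q a : ℝ) := by
      exact_mod_cast Nat.succ_le_of_lt (Finset.prod_pos fun a _ => hdim.1 a)
    have hρ : 1 ≤ √(Cx / cx) := Real.one_le_sqrt.2 ((one_le_div hcx).2 hcC.le)
    have hlog : 0 ≤ Real.log (6 * √(Cx / cx) * ((m : ℝ) + n + 1)) := by
      have h1 : (1 : ℝ) ≤ (m : ℝ) + n + 1 := by
        linarith [Nat.cast_nonneg (α := ℝ) m, Nat.cast_nonneg (α := ℝ) n]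
      exact Real.log_nonneg (one_le_mul_of_one_le_of_one_le (by linarith) h1)
    have hd := dLR_nonneg q p r
    have hexp : 1 ≤ Real.exp (-(1 / 16384 * ((0 : ℕ) : ℝ) *
        min (cx / (σ : ℝ) ^ 2) (cx ^ 2 / (σ : ℝ) ^ 4)) + (0.5 * ((m : ℝ) + n) + 2) *
          Real.log (6 * √(Cx / cx) * ((m : ℝ) + n + 1)) * dLR q p r) := by
      refine Real.one_le_exp ?_
      rw [Nat.cast_zero, mul_zero, zero_mul, neg_zero, zero_add]
      positivity
    have h1 := Real.exp_pos (-(δ ^ 2 * (0.5 * ((m : ℝ) + n) + 2) *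
      Real.log (6 * (m : ℝ) + 6 * n + 6) * dLR q p r))
    have h2 := one_le_mul_of_one_le_of_one_le hQ hexp
    rw [measureReal_empty]
    linarith
  exact exists_event_of_nondegenerate hn hN hdim.1 hdim.2 hr hcx hcC hX hE hind hA₀ hY hδ
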